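/- Let $b>0$ and let $H_0=\Pi_1^2+\Pi_2^2$, where $\Pi_j=-i\,\partial/\partial x_j-A_{0,j}$ and $A_0=\frac b2(-x_2,x_1)$, be the Landau Hamiltonian in $L^2(\mathbb R^2)$, i.e. the closure of this operator from $C_0^\infty(\mathbb R^2)$. For $q\in\mathbb Z_+=\{0,1,2,\dots\}$ let $P_q$ be the orthogonal projection onto $\mathrm{Ker}(H_0-\Lambda_q)$, $\Lambda_q=b(2q+1)$. With $z=x_1+ix_2$, $\partial/\partial z=\frac12(\partial_{x_1}-i\partial_{x_2})$ and $\partial/\partial\overline z=\frac12(\partial_{x_1}+i\partial_{x_2})$, let $$a=-2i\left(\frac{\partial}{\partial\overline z}+\frac{bz}{4}\right),\qquad a^*=-2i\left(\frac{\partial}{\partial z}-\frac{b\overline z}{4}\right)$$ be the magnetic annihilation and creation operators, closed on their common domain $\mathrm{Dom}\,H_0^{1/2}$, and let $\mathbb A:\mathrm{Dom}\,H_0^{1/2}\to L^2(\mathbb R^2;\mathbb C^2)$, $\mathbb Au=(a^*u,au)^{T}$. For $s,m\in\mathbb Z_+$ let $$\mathrm L_s^{(m)}(t)=\sum_{j=0}^s\binom{s+m}{s-j}\frac{(-t)^j}{j!},\qquad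 \mathrm L_s=\mathrm L_s^{(0)},$$ so that $\mathrm L_s^{(m)}\left(-\frac{\Delta}{2b}\right)=\sum_{j=0}^s\binom{s+m}{s-j}\frac{\Delta^j}{j!(2b)^j}$, $\Delta$ being the Laplacian in $\mathbb R^2$. **Proposition.** Let $\Omega=\{\omega_{jk}\}_{j,k=1,2}$ be a Hermitian $2\times2$ matrix-valued function on $\mathbb R^2$ whose entries are in $C_b^\infty(\mathbb R^2)$, i.e. are smooth and bounded together with all their derivatives. Fix $q\in\mathbb Z_+$. Then the operator $P_q\mathbb A^*\Omega\mathbb AP_q$ is defined on the whole of $P_qL^2(\mathbb R^2)$, and, as an operator in this space, it is unitarily equivalent to the operator $P_0w_qP_0$ with domain $P_0L^2(\mathbb R^2)$, where $w_q$ acts as the multiplication by the bounded function $$w_q=2b(q+1)\,\mathrm L_{q+1}\left(-\tfrac{\Delta}{2b}\right)\omega_{11}+2bq\,\mathrm L_{q-1}\left(-\tfrac{\Delta}{2b}\right)\omega_{22}-8\,\mathrm{Re}\,\mathrm L_{q-1}^{(2)}\left(-\tfrac{\Delta}{2b}\right)\frac{\partial^2\omega_{12}}{\partial\overline z^2}\quad\text{if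 } q\ge1,$$ $$w_0=2b\,\mathrm L_1\left(-\tfrac{\Delta}{2b}\right)\omega_{11}\quad\text{if } q=0.$$ -/

import Mathlib

open MeasureTheory Polynomial
open scoped ContDiff Laplacian ComplexConjugate InnerProductSpace

noncomputable section

namespace Landau

/-- The Euclidean plane `ℝ²`, with points `x = (x 0, x 1)`. -/
abbrev Plane : Type := EuclideanSpace ℝ (Fin 2)

/-- The complex Hilbert space `L²(ℝ²)` (Lebesgue measure). -/
abbrev L2 : Type := Lp ℂ 2 (volume : Measure Plane)

/-- `L²(ℝ²; ℂ²)`, as the Hilbert sum of two copies of `L²(ℝ²)`. -/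
abbrev L2x2 : Type := PiLp 2 (fun _ : Fin 2 => L2)

/-! ### Differential operators on functions -/

/-- The partial derivative `∂f/∂x_j`. -/
def pderiv (j : Fin 2) (f : Plane → ℂ) (x : Plane) : ℂ :=
  fderiv ℝ f x (EuclideanSpace.single j 1)

/-- `∂/∂z̄ = (∂/∂x₁ + i ∂/∂x₂) / 2`. -/
def dzbar (f : Plane → ℂ) (x : Plane) : ℂ :=
  (1 / 2) * (pderiv 0 f x + Complex.I * pderiv 1 f x)

/-- The space `C_b^∞(ℝ²)`: smooth functions, bounded together with all their derivatives. -/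
def IsCbInfty (f : Plane → ℂ) : Prop :=
  ContDiff ℝ ∞ f ∧ ∀ n : ℕ, ∃ C : ℝ, ∀ x, ‖iteratedFDeriv ℝ n f x‖ ≤ C

/-- The generalized Laguerre polynomial
`L_s^{(m)}(t) = ∑_{j=0}^s binom(s+m, s-j) (-t)^j / j!`. -/
def laguerre (s m : ℕ) : ℝ[X] :=
  ∑ j ∈ Finset.range (s + 1),
    Polynomial.C (((s + m).choose (s - j) : ℝ) * (-1) ^ j / (j.factorial : ℝ)) * X ^ j

/-- The constant coefficient differential operation `p(-Δ/(2b))` for a real polynomial `p`,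
`Δ` being the standard Laplacian on `ℝ²`. -/
def polyLaplacian (b : ℝ) (p : ℝ[X]) (f : Plane → ℂ) (x : Plane) : ℂ :=
  p.sum fun j c => (c : ℂ) * (-1 / (2 * (b : ℂ))) ^ j * (Laplacian.laplacian^[j] f) x

/-- The symbol `w_q(Ω)`. -/
def symbol (b : ℝ) (q : ℕ) (Ω : Plane → Matrix (Fin 2) (Fin 2) ℂ) (x : Plane) : ℂ :=
  if q = 0 then
    2 * b * polyLaplacian b (laguerre 1 0) (fun y => Ω y 0 0) x
  else
    2 * b * (q + 1) * polyLaplacian b (laguerre (q + 1) 0) (fun y => Ω y 0 0) x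
      + 2 * b * q * polyLaplacian b (laguerre (q - 1) 0) (fun y => Ω y 1 1) x
      - 8 * ((polyLaplacian b (laguerre (q - 1) 2) (dzbar (dzbar fun y => Ω y 0 1)) x).re : ℂ)

/-! ### Test functions and formal differential operators -/

/-- The space `C_0^∞(ℝ²)` of complex valued smooth compactly supported functions. -/
def testFn : Submodule ℂ (Plane → ℂ) where
  carrier := {f | ContDiff ℝ ∞ f ∧ HasCompactSupport f}
  add_mem' hf hg := ⟨hf.1.add hg.1, hf.2.add hg.2⟩
  zero_mem' := ⟨contDiff_const, HasCompactSupport.zero⟩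
  smul_mem' c _ hf := ⟨contDiff_const.smul hf.1, hf.2.smul_left (f := fun _ => c)⟩

/-- `∂/∂x_j` on test functions. -/
def partialOp (j : Fin 2) : Module.End ℂ testFn where
  toFun f := ⟨pderiv j f.1, (f.2.1.fderiv_right (m := ∞) (by simp)).clm_apply contDiff_const,
    (f.2.2.fderiv ℝ).mono fun x hx h => hx (by simp [pderiv, h])⟩
  map_add' f g := by
    ext x
    have hf := (f.2.1.differentiable (by simp)) x
    have hg := (g.2.1.differentiable (by simp)) x
    simp [pderiv, fderiv_add hf hg]
  map_smul' c f := by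
    ext x
    have hf := (f.2.1.differentiable (by simp)) x
    simp [pderiv, fderiv_const_smul hf c]

/-- Multiplication by the coordinate `x_j` on test functions. -/
def coordOp (j : Fin 2) : Module.End ℂ testFn where
  toFun f := ⟨fun x => (x j : ℂ) * f.1 x,
    (Complex.ofRealCLM.contDiff.comp (by fun_prop : ContDiff ℝ ∞ fun x : Plane => x j)).mul f.2.1,
    f.2.2.mul_left⟩
  map_add' f g := by ext x; simp [mul_add]
  map_smul' c f := by ext x; simp [mul_left_comm]

/-- The magnetic potential `A₀ = (b/2)(-x₂, x₁)`, as multiplication operators. -/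
def potential (b : ℝ) (j : Fin 2) : Module.End ℂ testFn :=
  if j = 0 then -(((b : ℂ) / 2) • coordOp 1) else ((b : ℂ) / 2) • coordOp 0

/-- `Π_j = -i ∂/∂x_j - A_{0,j}`. -/
def momentum (b : ℝ) (j : Fin 2) : Module.End ℂ testFn :=
  -(Complex.I • partialOp j) - potential b j

/-- The Landau Hamiltonian `Π₁² + Π₂²` on test functions. -/
def landau (b : ℝ) : Module.End ℂ testFn :=
  momentum b 0 ^ 2 + momentum b 1 ^ 2

/-- `∂/∂z` on test functions. -/
def dzOp : Module.End ℂ testFn := (1 / 2 : ℂ) • (partialOp 0 - Complex.I • partialOp 1)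

/-- `∂/∂z̄` on test functions. -/
def dzbarOp : Module.End ℂ testFn := (1 / 2 : ℂ) • (partialOp 0 + Complex.I • partialOp 1)

/-- The annihilation operator `-2i (∂/∂z̄ + b z / 4)` on test functions. -/
def annihilation (b : ℝ) : Module.End ℂ testFn :=
  (-2 * Complex.I) • (dzbarOp + ((b : ℂ) / 4) • (coordOp 0 + Complex.I • coordOp 1))

/-- The creation operator `-2i (∂/∂z - b z̄ / 4)` on test functions. -/
def creation (b : ℝ) : Module.End ℂ testFn :=
  (-2 * Complex.I) • (dzOp - ((b : ℂ) / 4) • (coordOp 0 - Complex.I • coordOp 1))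

/-! ### Closed operators in `L²(ℝ²)` -/

theorem memLp_testFn (f : testFn) : MemLp f.1 2 (volume : Measure Plane) :=
  f.2.1.continuous.memLp_of_hasCompactSupport f.2.2

/-- The inclusion `C_0^∞(ℝ²) → L²(ℝ²)`. -/
def toL2 : testFn →ₗ[ℂ] L2 where
  toFun f := (memLp_testFn f).toLp f.1
  map_add' _ _ := rfl
  map_smul' _ _ := rfl

theorem toL2_injective : Function.Injective toL2 := by
  intro f g h
  have h' := (MemLp.toLp_eq_toLp_iff (memLp_testFn f) (memLp_testFn g)).1 h
  exact Subtype.ext ((f.2.1.continuous.ae_eq_iff_eq volume g.2.1.continuous).1 h')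

/-- The operator in `L²(ℝ²)` with domain `C_0^∞(ℝ²)` given by a formal operator `D`. -/
def minimalOp (D : Module.End ℂ testFn) : L2 →ₗ.[ℂ] L2 where
  domain := LinearMap.range toL2
  toFun := toL2 ∘ₗ D ∘ₗ (LinearEquiv.ofInjective toL2 toL2_injective).symm.toLinearMap

/-- The closure in `L²(ℝ²)` of `D` defined on `C_0^∞(ℝ²)`. -/
def closedOp (D : Module.End ℂ testFn) : L2 →ₗ.[ℂ] L2 := (minimalOp D).closure

/-- The Landau Hamiltonian `H₀`: the closure of `Π₁² + Π₂²` from `C_0^∞(ℝ²)`,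
on which it is essentially self-adjoint. -/
def H0 (b : ℝ) : L2 →ₗ.[ℂ] L2 := closedOp (landau b)

/-- The closed annihilation operator `a`. -/
def opA (b : ℝ) : L2 →ₗ.[ℂ] L2 := closedOp (annihilation b)

/-- The closed creation operator `a*`. -/
def opAstar (b : ℝ) : L2 →ₗ.[ℂ] L2 := closedOp (creation b)

/-- The operator `𝔸 u = (a* u, a u)` from `L²(ℝ²)` to `L²(ℝ²; ℂ²)`, on the common domain of
`a*` and `a`. This is the closure of `C_0^∞(ℝ²)` in the norm
`(‖u‖² + ‖a* u‖² + ‖a u‖²)^{1/2} = (‖u‖² + 2 ‖H₀^{1/2} u‖²)^{1/2}`, that is, `Dom H₀^{1/2}`. -/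
def bigA (b : ℝ) : L2 →ₗ.[ℂ] L2x2 where
  domain := (opAstar b).domain ⊓ (opA b).domain
  toFun :=
    { toFun := fun u => WithLp.toLp 2 ![opAstar b ⟨u.1, u.2.1⟩, opA b ⟨u.1, u.2.2⟩]
      map_add' := fun u v => by
        ext1 i
        fin_cases i
        · exact (opAstar b).map_add ⟨u.1, u.2.1⟩ ⟨v.1, v.2.1⟩
        · exact (opA b).map_add ⟨u.1, u.2.2⟩ ⟨v.1, v.2.2⟩
      map_smul' := fun c u => by
        ext1 i
        fin_cases i
        · exact (opAstar b).map_smul c ⟨u.1, u.2.1⟩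
        · exact (opA b).map_smul c ⟨u.1, u.2.2⟩ }

/-! ### Composition, multiplication and unitary equivalence of operators -/

section Abstract

variable {E F G : Type*} [NormedAddCommGroup E] [InnerProductSpace ℂ E]
  [NormedAddCommGroup F] [InnerProductSpace ℂ F] [NormedAddCommGroup G] [InnerProductSpace ℂ G]

/-- The composition `g f` of partially defined operators, with its natural domain
`{x ∈ Dom f | f x ∈ Dom g}`. -/
def pcomp (g : F →ₗ.[ℂ] G) (f : E →ₗ.[ℂ] F) : E →ₗ.[ℂ] G where
  domain :=
    { carrier := {x | ∃ h : x ∈ f.domain, f ⟨x, h⟩ ∈ g.domain}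
      add_mem' := by
        rintro x y ⟨hx, hx'⟩ ⟨hy, hy'⟩
        refine ⟨f.domain.add_mem hx hy, ?_⟩
        have := f.map_add ⟨x, hx⟩ ⟨y, hy⟩
        rw [AddMemClass.mk_add_mk] at this
        rw [this]
        exact g.domain.add_mem hx' hy'
      zero_mem' := ⟨f.domain.zero_mem, by
        have : f ⟨0, f.domain.zero_mem⟩ = 0 := f.map_zero
        rw [this]; exact g.domain.zero_mem⟩
      smul_mem' := by
        rintro c x ⟨hx, hx'⟩
        refine ⟨f.domain.smul_mem c hx, ?_⟩
        have := f.map_smul c ⟨x, hx⟩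
        rw [SetLike.mk_smul_mk] at this
        rw [this]
        exact g.domain.smul_mem c hx' }
  toFun :=
    { toFun := fun x => g ⟨f ⟨x.1, x.2.fst⟩, x.2.snd⟩
      map_add' := fun x y => by
        rw [← g.map_add]
        congr 1
        exact Subtype.ext (f.map_add ⟨x.1, x.2.fst⟩ ⟨y.1, y.2.fst⟩)
      map_smul' := fun c x => by
        rw [RingHom.id_apply, ← g.map_smul]
        congr 1
        exact Subtype.ext (f.map_smul c ⟨x.1, x.2.fst⟩) }

/-- An everywhere defined linear map, seen as a partially defined one. -/
def everywhere (f : E →ₗ[ℂ] F) : E →ₗ.[ℂ] F := f.toPMap ⊤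

/-- Unitary equivalence: some unitary operator from `E` onto `F` carries `T` to `S`
(domains included). -/
def UnitarilyEquivalent (T : E →ₗ.[ℂ] E) (S : F →ₗ.[ℂ] F) : Prop :=
  ∃ W : E ≃ₗᵢ[ℂ] F, ∀ x y : E, (x, y) ∈ T.graph ↔ (W x, W y) ∈ S.graph

/-- The eigenspace `Ker (T - c)` of a partially defined operator. -/
def eigenspace (T : E →ₗ.[ℂ] E) (c : ℂ) : Submodule ℂ E :=
  (LinearMap.ker (T.toFun - c • T.domain.subtype)).map T.domain.subtype

theorem mem_eigenspace {T : E →ₗ.[ℂ] E} {c : ℂ} {x : E} :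
    x ∈ eigenspace T c ↔ (x, c • x) ∈ T.graph := by
  simp only [eigenspace, Submodule.mem_map, LinearMap.mem_ker, LinearMap.sub_apply,
    LinearMap.smul_apply, Submodule.subtype_apply, sub_eq_zero, LinearPMap.mem_graph_iff]
  constructor
  · rintro ⟨y, hy, rfl⟩
    exact ⟨y, rfl, hy⟩
  · rintro ⟨y, rfl, hy⟩
    exact ⟨y, hy, rfl⟩

theorem isClosed_eigenspace {T : E →ₗ.[ℂ] E} (hT : T.IsClosed) (c : ℂ) :
    IsClosed (eigenspace T c : Set E) := by
  have : (eigenspace T c : Set E) = (fun x => (x, c • x)) ⁻¹' (T.graph : Set (E × E)) := by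
    ext x
    exact mem_eigenspace
  rw [this]
  exact IsClosed.preimage (by fun_prop) hT

end Abstract

theorem ae_mul_add (w : Plane → ℂ) (u v : L2) :
    (fun x => w x * (u + v : L2) x) =ᵐ[volume] fun x => w x * u x + w x * v x := by
  filter_upwards [Lp.coeFn_add u v] with x hx
  rw [hx, Pi.add_apply, mul_add]

theorem ae_mul_smul (w : Plane → ℂ) (c : ℂ) (u : L2) :
    (fun x => w x * (c • u : L2) x) =ᵐ[volume] fun x => c • (w x * u x) := by
  filter_upwards [Lp.coeFn_smul c u] with x hx
  rw [hx, Pi.smul_apply, smul_eq_mul, smul_eq_mul, mul_left_comm]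

theorem ae_mul_zero (w : Plane → ℂ) :
    (fun x => w x * (0 : L2) x) =ᵐ[volume] fun _ => 0 := by
  filter_upwards [Lp.coeFn_zero ℂ 2 (volume : Measure Plane)] with x hx
  rw [hx, Pi.zero_apply, mul_zero]

/-- The maximal domain `{u ∈ L² | w u ∈ L²}` of the multiplication by `w`. -/
def mulDomain (w : Plane → ℂ) : Submodule ℂ L2 where
  carrier := {u | MemLp (fun x => w x * u x) 2 (volume : Measure Plane)}
  add_mem' {u v} hu hv := (hu.add hv).ae_eq (ae_mul_add w u v).symm
  zero_mem' := (MemLp.zero (ε := ℂ)).ae_eq (ae_mul_zero w).symm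
  smul_mem' c u hu := (hu.const_smul c).ae_eq (ae_mul_smul w c u).symm

/-- Multiplication by a function `w`, with its maximal domain. -/
def mulOp (w : Plane → ℂ) : L2 →ₗ.[ℂ] L2 where
  domain := mulDomain w
  toFun :=
    { toFun := fun u => MemLp.toLp (fun x => w x * u.1 x) u.2
      map_add' := fun u v =>
        (MemLp.toLp_congr _ (u.2.add v.2) (ae_mul_add w u.1 v.1)).trans (MemLp.toLp_add u.2 v.2)
      map_smul' := fun c u =>
        (MemLp.toLp_congr _ (u.2.const_smul c) (ae_mul_smul w c u.1)).trans
          (MemLp.toLp_const_smul c u.2) }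

theorem ae_matMul_add (M : Plane → Fin 2 → ℂ) (U V : L2x2) :
    (fun x => ∑ k, M x k * (U + V) k x) =ᵐ[volume]
      fun x => (∑ k, M x k * U k x) + ∑ k, M x k * V k x := by
  filter_upwards [ae_mul_add (fun x => M x 0) (U 0) (V 0),
    ae_mul_add (fun x => M x 1) (U 1) (V 1)] with x h0 h1
  rw [Fin.sum_univ_two, Fin.sum_univ_two, Fin.sum_univ_two, PiLp.add_apply, PiLp.add_apply, h0, h1]
  ring

theorem ae_matMul_smul (M : Plane → Fin 2 → ℂ) (c : ℂ) (U : L2x2) :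
    (fun x => ∑ k, M x k * (c • U) k x) =ᵐ[volume] fun x => c • ∑ k, M x k * U k x := by
  filter_upwards [ae_mul_smul (fun x => M x 0) c (U 0),
    ae_mul_smul (fun x => M x 1) c (U 1)] with x h0 h1
  rw [Fin.sum_univ_two, Fin.sum_univ_two, PiLp.smul_apply, PiLp.smul_apply, h0, h1, smul_add]

theorem ae_matMul_zero (M : Plane → Fin 2 → ℂ) :
    (fun x => ∑ k, M x k * (0 : L2x2) k x) =ᵐ[volume] fun _ => 0 := by
  filter_upwards [ae_mul_zero (fun x => M x 0), ae_mul_zero (fun x => M x 1)] with x h0 h1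
  rw [Fin.sum_univ_two, PiLp.zero_apply, PiLp.zero_apply, h0, h1, add_zero]

/-- The maximal domain of the multiplication by the matrix-valued function `Ω`. -/
def matMulDomain (Ω : Plane → Matrix (Fin 2) (Fin 2) ℂ) : Submodule ℂ L2x2 where
  carrier := {U | ∀ j, MemLp (fun x => ∑ k, Ω x j k * U k x) 2 (volume : Measure Plane)}
  add_mem' {U V} hU hV j :=
    ((hU j).add (hV j)).ae_eq (ae_matMul_add (fun x => Ω x j) U V).symm
  zero_mem' j := (MemLp.zero (ε := ℂ)).ae_eq (ae_matMul_zero (fun x => Ω x j)).symm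
  smul_mem' c U hU j := ((hU j).const_smul c).ae_eq (ae_matMul_smul (fun x => Ω x j) c U).symm

/-- Multiplication by a matrix-valued function `Ω` in `L²(ℝ²; ℂ²)`, with its maximal domain. -/
def matMulOp (Ω : Plane → Matrix (Fin 2) (Fin 2) ℂ) : L2x2 →ₗ.[ℂ] L2x2 where
  domain := matMulDomain Ω
  toFun :=
    { toFun := fun U =>
        WithLp.toLp 2 fun j => MemLp.toLp (fun x => ∑ k, Ω x j k * U.1 k x) (U.2 j)
      map_add' := fun U V => by
        ext1 j
        exact (MemLp.toLp_congr ((U + V).2 j) ((U.2 j).add (V.2 j))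
          (ae_matMul_add (fun x => Ω x j) U.1 V.1)).trans (MemLp.toLp_add (U.2 j) (V.2 j))
      map_smul' := fun c U => by
        ext1 j
        exact (MemLp.toLp_congr ((c • U).2 j) ((U.2 j).const_smul c)
          (ae_matMul_smul (fun x => Ω x j) c U.1)).trans (MemLp.toLp_const_smul c (U.2 j)) }

/-! ### Closedness of the Landau Hamiltonian -/

theorem dense_range_toL2 : Dense (LinearMap.range toL2 : Set L2) := by
  refine (Lp.dense_hasCompactSupport_contDiff (F := ℂ) (E := Plane) (μ := volume) (p := 2)
    (by simp)).mono ?_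
  rintro u ⟨f, hu, hc, hd⟩
  refine ⟨⟨f, hd, hc⟩, ?_⟩
  refine Lp.ext ?_
  exact (MemLp.coeFn_toLp (memLp_testFn ⟨f, hd, hc⟩)).trans hu.symm

theorem inner_toL2 (f g : testFn) : inner ℂ (toL2 f) (toL2 g) = ∫ x, conj (f.1 x) * g.1 x := by
  rw [L2.inner_def]
  refine integral_congr_ae ?_
  filter_upwards [MemLp.coeFn_toLp (memLp_testFn f), MemLp.coeFn_toLp (memLp_testFn g)]
    with x hf hg
  change inner ℂ ((memLp_testFn f).toLp f.1 x) ((memLp_testFn g).toLp g.1 x) = _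
  rw [hf, hg]
  simp [mul_comm]

/-- `D'` is a formal adjoint of `D` on test functions. -/
def IsFormalAdj (D D' : Module.End ℂ testFn) : Prop :=
  ∀ f g : testFn, inner ℂ (toL2 (D f)) (toL2 g) = inner ℂ (toL2 f) (toL2 (D' g))

theorem isFormalAdj_coordOp (j : Fin 2) : IsFormalAdj (coordOp j) (coordOp j) := by
  intro f g
  rw [inner_toL2, inner_toL2]
  congr 1
  ext x
  simp [coordOp]
  ring

theorem isFormalAdj_partialOp (j : Fin 2) : IsFormalAdj (partialOp j) (-partialOp j) := by
  intro f g
  rw [inner_toL2, inner_toL2]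
  have hcf : ContDiff ℝ ∞ fun x => conj (f.1 x) := Complex.conjCLE.contDiff.comp f.2.1
  have hcs : HasCompactSupport fun x => conj (f.1 x) :=
    f.2.2.comp_left (g := fun z : ℂ => conj z) (map_zero _)
  have hfd : Differentiable ℝ fun x => conj (f.1 x) := hcf.differentiable (by simp)
  have hgd : Differentiable ℝ g.1 := g.2.1.differentiable (by simp)
  have hder : ∀ x, fderiv ℝ (fun x => conj (f.1 x)) x (EuclideanSpace.single j 1)
      = conj ((partialOp j f).1 x) := by
    intro x
    have h := Complex.conjCLE.toContinuousLinearMap.hasFDerivAt.comp x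
      ((f.2.1.differentiable (by simp)) x).hasFDerivAt
    have h2 : HasFDerivAt (fun x => conj (f.1 x)) _ x := h
    rw [h2.fderiv]
    rfl
  have key := integral_mul_fderiv_eq_neg_fderiv_mul_of_integrable (μ := (volume : Measure Plane))
    (f := fun x => conj (f.1 x)) (g := g.1) (v := EuclideanSpace.single j 1) ?_ ?_ ?_
    (fun x _ => hfd x) (fun x _ => hgd x)
  · simp only [hder] at key
    rw [← neg_eq_iff_eq_neg] at key
    rw [← key, ← integral_neg]
    refine integral_congr_ae (Filter.Eventually.of_forall fun x => ?_)
    change -(conj (f.1 x) * (partialOp j g).1 x) = conj (f.1 x) * -(partialOp j g).1 x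
    ring
  · simp only [hder]
    exact ((Complex.continuous_conj.comp (partialOp j f).2.1.continuous).mul
      g.2.1.continuous).integrable_of_hasCompactSupport g.2.2.mul_left
  · exact (hcf.continuous.mul (partialOp j g).2.1.continuous).integrable_of_hasCompactSupport
      hcs.mul_right
  · exact (hcf.continuous.mul g.2.1.continuous).integrable_of_hasCompactSupport hcs.mul_right

theorem IsFormalAdj.add {D D' K K' : Module.End ℂ testFn} (h : IsFormalAdj D D')
    (k : IsFormalAdj K K') : IsFormalAdj (D + K) (D' + K') := fun f g => by
  simp only [LinearMap.add_apply, map_add, inner_add_left, inner_add_right, h f g, k f g]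

theorem IsFormalAdj.smul {D D' : Module.End ℂ testFn} (h : IsFormalAdj D D') (c : ℂ) :
    IsFormalAdj (c • D) (conj c • D') := fun f g => by
  simp only [LinearMap.smul_apply, map_smul, inner_smul_left, inner_smul_right, h f g]

theorem IsFormalAdj.neg {D D' : Module.End ℂ testFn} (h : IsFormalAdj D D') :
    IsFormalAdj (-D) (-D') := fun f g => by
  simp only [LinearMap.neg_apply, map_neg, inner_neg_left, inner_neg_right, h f g]

theorem IsFormalAdj.mul {D D' K K' : Module.End ℂ testFn} (h : IsFormalAdj D D')
    (k : IsFormalAdj K K') : IsFormalAdj (D * K) (K' * D') := fun f g => by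
  rw [Module.End.mul_apply, Module.End.mul_apply, h, k]

theorem isFormalAdj_momentum (b : ℝ) (j : Fin 2) :
    IsFormalAdj (momentum b j) (momentum b j) := by
  have h1 : IsFormalAdj (-(Complex.I • partialOp j)) (-(Complex.I • partialOp j)) := by
    have e : -(conj Complex.I • -partialOp j) = -(Complex.I • partialOp j) := by
      rw [Complex.conj_I]
      module
    have := ((isFormalAdj_partialOp j).smul Complex.I).neg
    exact e ▸ this
  have h2 : IsFormalAdj (potential b j) (potential b j) := by
    have hb : conj ((b : ℂ) / 2) = (b : ℂ) / 2 := by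
      rw [map_div₀, Complex.conj_ofReal, map_ofNat]
    have h0 := (isFormalAdj_coordOp 0).smul ((b : ℂ) / 2)
    have h1 := ((isFormalAdj_coordOp 1).smul ((b : ℂ) / 2)).neg
    rw [hb] at h0 h1
    unfold potential
    split_ifs
    exacts [h1, h0]
  have e : momentum b j = -(Complex.I • partialOp j) + -potential b j := by
    unfold momentum
    module
  rw [e]
  exact h1.add h2.neg

theorem isFormalAdj_landau (b : ℝ) : IsFormalAdj (landau b) (landau b) := by
  unfold landau
  rw [sq, sq]
  exact ((isFormalAdj_momentum b 0).mul (isFormalAdj_momentum b 0)).add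
    ((isFormalAdj_momentum b 1).mul (isFormalAdj_momentum b 1))

theorem minimalOp_toL2 (D : Module.End ℂ testFn) (f : testFn) (h : toL2 f ∈ (minimalOp D).domain) :
    minimalOp D ⟨toL2 f, h⟩ = toL2 (D f) := by
  have : (LinearEquiv.ofInjective toL2 toL2_injective).symm ⟨toL2 f, h⟩ = f := by
    rw [LinearEquiv.symm_apply_eq]
    rfl
  change toL2 (D ((LinearEquiv.ofInjective toL2 toL2_injective).symm ⟨toL2 f, h⟩)) = _
  rw [this]

theorem IsFormalAdj.isClosable {D D' : Module.End ℂ testFn} (h : IsFormalAdj D D') :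
    (minimalOp D).IsClosable := by
  have hf : (minimalOp D').IsFormalAdjoint (minimalOp D) := by
    rintro ⟨_, g, rfl⟩ ⟨_, f, rfl⟩
    have := congrArg conj (h f g)
    rw [inner_conj_symm, inner_conj_symm] at this
    have e1 := minimalOp_toL2 D' g ⟨g, rfl⟩
    have e2 := minimalOp_toL2 D f ⟨f, rfl⟩
    exact (congrArg (fun v => inner ℂ v (toL2 f)) e1).trans
      (this.symm.trans (congrArg (fun v => inner ℂ (toL2 g) v) e2.symm))
  exact ((minimalOp D').adjoint_isClosed dense_range_toL2).isClosable.leIsClosable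
    (hf.le_adjoint dense_range_toL2)

theorem isClosed_H0 (b : ℝ) : (H0 b).IsClosed :=
  (isFormalAdj_landau b).isClosable.closure_isClosed

theorem isFormalAdj_annihilation_creation (b : ℝ) :
    IsFormalAdj (annihilation b) (creation b) := by
  have hI := fun {D D' : Module.End ℂ testFn} (h : IsFormalAdj D D') => h.smul Complex.I
  have h := (((((isFormalAdj_partialOp 0).add (hI (isFormalAdj_partialOp 1))).smul (1 / 2)).add
    (((isFormalAdj_coordOp 0).add (hI (isFormalAdj_coordOp 1))).smul
      ((b : ℂ) / 4))).smul (-2 * Complex.I))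
  have e : creation b = conj (-2 * Complex.I) • (conj (1 / 2 : ℂ) • (-partialOp 0 +
      conj Complex.I • -partialOp 1) + conj ((b : ℂ) / 4) • (coordOp 0 +
      conj Complex.I • coordOp 1)) := by
    simp only [creation, dzOp, map_mul, map_neg, map_div₀, map_ofNat, map_one, Complex.conj_I,
      Complex.conj_ofReal]
    module
  rw [e]
  exact h

theorem isClosed_opA (b : ℝ) : (opA b).IsClosed :=
  (isFormalAdj_annihilation_creation b).isClosable.closure_isClosed

theorem IsFormalAdj.symm {D D' : Module.End ℂ testFn} (h : IsFormalAdj D D') :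
    IsFormalAdj D' D := fun f g => by
  have := congrArg conj (h g f)
  rw [inner_conj_symm, inner_conj_symm] at this
  exact this.symm

theorem isClosed_opAstar (b : ℝ) : (opAstar b).IsClosed :=
  (isFormalAdj_annihilation_creation b).symm.isClosable.closure_isClosed

theorem dense_domain_bigA (b : ℝ) : Dense ((bigA b).domain : Set L2) :=
  dense_range_toL2.mono fun _ hu => ⟨(minimalOp (creation b)).le_closure.1 hu,
    (minimalOp (annihilation b)).le_closure.1 hu⟩

/-! ### Landau levels and the operators of Berezin-Toeplitz type -/

/-- The subspace `P_q L²(ℝ²) = Ker (H₀ - Λ_q)`, where `Λ_q = b (2 q + 1)`. -/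
def level (b : ℝ) (q : ℕ) : Submodule ℂ L2 := eigenspace (H0 b) ((b : ℂ) * (2 * q + 1))

instance (b : ℝ) (q : ℕ) : CompleteSpace (level b q) :=
  (isClosed_eigenspace (isClosed_H0 b) _).completeSpace_coe

/-- The orthogonal projection `P_q`, as a map from `L²(ℝ²)` onto `P_q L²(ℝ²)`. -/
def levelProj (b : ℝ) (q : ℕ) : L2 →ₗ[ℂ] level b q := (level b q).orthogonalProjectionOnto.toLinearMap

/-- The compression `P_q T P_q` of an operator `T` in `L²(ℝ²)`, acting in `P_q L²(ℝ²)`. -/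
def compression (b : ℝ) (q : ℕ) (T : L2 →ₗ.[ℂ] L2) : level b q →ₗ.[ℂ] level b q :=
  pcomp (everywhere (levelProj b q)) (pcomp T (everywhere (level b q).subtype))

/-- The operator `𝔸* Ω 𝔸` in `L²(ℝ²)`. -/
def sandwich (b : ℝ) (Ω : Plane → Matrix (Fin 2) (Fin 2) ℂ) : L2 →ₗ.[ℂ] L2 :=
  pcomp (bigA b).adjoint (pcomp (matMulOp Ω) (bigA b))

end Landau

end

noncomputable section

namespace Landau

open Filter Topology

variable {b : ℝ}

/-! ### Calculus of partial derivatives -/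

/-! The engine is the ladder structure of the Landau levels. On test functions `[a, a*] = 2b` and
`H₀ = a* a + b`. Passing to closures, `a*` maps the `q`-th level onto the next one, multiplying
norms by `√(2b(q+1))`, and `a` undoes this up to the factor `2b(q+1)`. So the normalised `q`-th
power of `a*` is a unitary `e q` from level `0` onto level `q` (`exists_level_equiv_pow`), and its
inverse implements the equivalence.

The analytic point is that `a u` and `a* u`, for `u` in a level, are at first only weak eigenvectors
of `H₀`. They are eigenvectors of the closure because `H₀ + 1` has dense range on test functions
(`dense_range_landau_add_one`, `mem_graph_H0_of_weak`). Density is proved through moments: if `g` is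
orthogonal to the range, testing against cut-off functions `z^k z̄^l exp(-b|z|²/4)` gives a
recurrence that kills every moment of `ḡ exp(-b|z|²/4)`. This function decays faster than any
exponential, so its Fourier transform vanishes.

The symbol comes from an algebraic computation. Let `F n` and `F' n` be the images under `(a*)^n` of
two vectors of level `0`. On the level `q`, the form of `𝔸* Ω 𝔸` consists of matrix elements `⟨F' m,
w F n⟩` with `m, n ∈ {q+1, q-1}` and `w` an entry of `Ω`. The commutators of `a` and `a*` with `w`
are multiplications by `-2i ∂w/∂z̄` and `-2i ∂w/∂z`. Moving the ladder operators across `w` reduces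
each matrix element to one between `F' 0` and `F 0`, with `w` replaced by a Laguerre polynomial in
the Laplacian applied to derivatives of `w` (`laguerre_sum_of_commutator_recurrence`,
`inner_ladder_mulL2`). Collecting the four entries yields `w_q` (`IsLadder.form_eq`).

Closed operators are handled through their graphs (`Ann`, `Cre`), so domain questions become
existence statements. -/

theorem pderiv_mul {j : Fin 2} {f g : Plane → ℂ} {x : Plane} (hf : DifferentiableAt ℝ f x)
    (hg : DifferentiableAt ℝ g x) :
    pderiv j (fun y => f y * g y) x = pderiv j f x * g x + f x * pderiv j g x := by
  unfold pderiv
  rw [fderiv_fun_mul hf hg]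
  simp
  ring

theorem pderiv_coord (j k : Fin 2) (x : Plane) :
    pderiv j (fun y => (y k : ℂ)) x = if j = k then 1 else 0 := by
  have h : HasFDerivAt (fun y : Plane => (y k : ℂ))
      (Complex.ofRealCLM ∘L (EuclideanSpace.proj k : Plane →L[ℝ] ℝ)) x :=
    (Complex.ofRealCLM ∘L (EuclideanSpace.proj k : Plane →L[ℝ] ℝ)).hasFDerivAt
  unfold pderiv
  rw [h.fderiv]
  fin_cases j <;> fin_cases k <;> simp

theorem contDiff_coord (k : Fin 2) : ContDiff ℝ ∞ fun y : Plane => (y k : ℂ) :=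
  Complex.ofRealCLM.contDiff.comp (by fun_prop : ContDiff ℝ ∞ fun x : Plane => x k)

theorem contDiff_pderiv {f : Plane → ℂ} (hf : ContDiff ℝ ∞ f) (j : Fin 2) :
    ContDiff ℝ ∞ (pderiv j f) :=
  (hf.fderiv_right (m := ∞) (by simp)).clm_apply contDiff_const

theorem pderiv_comm {f : Plane → ℂ} (hf : ContDiff ℝ ∞ f) (j k : Fin 2) :
    pderiv j (pderiv k f) = pderiv k (pderiv j f) := by
  have hd : Differentiable ℝ (fderiv ℝ f) :=
    (hf.fderiv_right (m := ∞) (by simp)).differentiable (by simp)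
  have key : ∀ (j k : Fin 2) (x : Plane), pderiv j (pderiv k f) x =
      fderiv ℝ (fderiv ℝ f) x (EuclideanSpace.single j 1) (EuclideanSpace.single k 1) := by
    intro j k x
    unfold pderiv
    rw [fderiv_clm_apply (hd x) (differentiableAt_const _)]
    simp
  ext x
  rw [key, key]
  have hs : IsSymmSndFDerivAt ℝ f x := (hf.contDiffAt).isSymmSndFDerivAt
    (by simpa using! (WithTop.coe_le_coe.2 le_top : ((2 : ℕ∞) : WithTop ℕ∞) ≤ ((⊤ : ℕ∞) : WithTop ℕ∞)))
  exact hs _ _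

/-- `∂/∂z = (∂/∂x₁ - i ∂/∂x₂) / 2`. -/
def dz (f : Plane → ℂ) (x : Plane) : ℂ :=
  (1 / 2) * (pderiv 0 f x - Complex.I * pderiv 1 f x)

/-! ### Commutation relations on test functions -/

theorem partialOp_mul_coordOp (j k : Fin 2) :
    partialOp j * coordOp k = coordOp k * partialOp j + if j = k then 1 else 0 := by
  ext f x
  have h := pderiv_mul (j := j) (x := x) ((contDiff_coord k).differentiable (by simp) x)
    (f.2.1.differentiable (by simp) x)
  rw [pderiv_coord] at h
  change pderiv j (fun y => (y k : ℂ) * f.1 y) x = _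
  rw [h]
  split_ifs
  · change _ = (x k : ℂ) * pderiv j f.1 x + f.1 x
    ring
  · change _ = (x k : ℂ) * pderiv j f.1 x + 0
    ring

theorem partialOp_comm : partialOp 1 * partialOp 0 = partialOp 0 * partialOp 1 := by
  ext f x
  exact congrFun (pderiv_comm f.2.1 1 0) x

theorem coordOp_comm : coordOp 1 * coordOp 0 = coordOp 0 * coordOp 1 := by
  ext f x
  exact mul_left_comm _ _ _

/-- A formal consequence of the Weyl relations. The hypotheses serve as rewriting rules that put
coordinates to the left of derivatives, after which only scalar coefficients remain to be compared.
-/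
theorem ladder_commutator {R : Type*} [Ring R] [Algebra ℂ R] {p₀ p₁ x₀ x₁ : R} (c : ℂ)
    (h00 : p₀ * x₀ = x₀ * p₀ + 1) (h01 : p₀ * x₁ = x₁ * p₀) (h10 : p₁ * x₀ = x₀ * p₁)
    (h11 : p₁ * x₁ = x₁ * p₁ + 1) (hp : p₁ * p₀ = p₀ * p₁) (hx : x₁ * x₀ = x₀ * x₁) :
    (p₀ + Complex.I • p₁ + c • (x₀ + Complex.I • x₁)) *
        (p₀ - Complex.I • p₁ - c • (x₀ - Complex.I • x₁)) =
      (p₀ - Complex.I • p₁ - c • (x₀ - Complex.I • x₁)) *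
        (p₀ + Complex.I • p₁ + c • (x₀ + Complex.I • x₁)) + (-(4 * c)) • 1 := by
  simp only [mul_add, add_mul, mul_sub, sub_mul, smul_mul_assoc, mul_smul_comm, h00, h01, h10, h11,
    hp, hx, smul_add, smul_sub, smul_smul]
  have hI : Complex.I ^ 2 = -1 := Complex.I_sq
  match_scalars <;> ring_nf <;> simp only [hI] <;> ring

theorem sq_add_sq_eq_ladder {R : Type*} [Ring R] [Algebra ℂ R] {p₀ p₁ x₀ x₁ : R} (c : ℂ)
    (h00 : p₀ * x₀ = x₀ * p₀ + 1) (h01 : p₀ * x₁ = x₁ * p₀) (h10 : p₁ * x₀ = x₀ * p₁)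
    (h11 : p₁ * x₁ = x₁ * p₁ + 1) (hp : p₁ * p₀ = p₀ * p₁) (hx : x₁ * x₀ = x₀ * x₁) :
    (-(Complex.I • p₀) + (2 * c) • x₁) ^ 2 + (-(Complex.I • p₁) - (2 * c) • x₀) ^ 2 =
      (-1 : ℂ) • ((p₀ - Complex.I • p₁ - (c + c) • (x₀ - Complex.I • x₁)) *
        (p₀ + Complex.I • p₁ + (c + c) • (x₀ + Complex.I • x₁))) + (4 * c) • 1 := by
  simp only [sq, mul_add, add_mul, mul_sub, sub_mul, neg_mul, mul_neg, smul_mul_assoc,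
    mul_smul_comm, h00, h01, h10, h11, hp, hx, smul_add, smul_sub, smul_neg, smul_smul]
  have hI : Complex.I ^ 2 = -1 := Complex.I_sq
  match_scalars <;> ring_nf <;> (try simp only [hI]) <;> ring

theorem partialOp_coordOp_relations :
    partialOp 0 * coordOp 0 = coordOp 0 * partialOp 0 + 1 ∧
    partialOp 0 * coordOp 1 = coordOp 1 * partialOp 0 ∧
    partialOp 1 * coordOp 0 = coordOp 0 * partialOp 1 ∧
    partialOp 1 * coordOp 1 = coordOp 1 * partialOp 1 + 1 :=
  ⟨partialOp_mul_coordOp 0 0, by simpa using partialOp_mul_coordOp 0 1,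
    by simpa using partialOp_mul_coordOp 1 0, partialOp_mul_coordOp 1 1⟩

theorem annihilation_eq (b : ℝ) : annihilation b = (-Complex.I) • (partialOp 0 +
    Complex.I • partialOp 1 + ((b : ℂ) / 2) • (coordOp 0 + Complex.I • coordOp 1)) := by
  unfold annihilation dzbarOp
  match_scalars <;> ring

theorem creation_eq (b : ℝ) : creation b = (-Complex.I) • (partialOp 0 -
    Complex.I • partialOp 1 - ((b : ℂ) / 2) • (coordOp 0 - Complex.I • coordOp 1)) := by
  unfold creation dzOp
  match_scalars <;> ring

theorem annihilation_mul_creation (b : ℝ) :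
    annihilation b * creation b = creation b * annihilation b + (2 * b : ℂ) • 1 := by
  obtain ⟨h00, h01, h10, h11⟩ := partialOp_coordOp_relations
  have h := ladder_commutator (R := Module.End ℂ testFn) ((b : ℂ) / 2) h00 h01 h10 h11 partialOp_comm coordOp_comm
  rw [annihilation_eq, creation_eq, smul_mul_smul_comm, smul_mul_smul_comm, h, smul_add, smul_smul]
  have : -Complex.I * -Complex.I = -1 := by rw [neg_mul_neg, Complex.I_mul_I]
  rw [this]
  congr 2
  ring

theorem landau_eq (b : ℝ) : landau b = creation b * annihilation b + (b : ℂ) • 1 := by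
  obtain ⟨h00, h01, h10, h11⟩ := partialOp_coordOp_relations
  have h := sq_add_sq_eq_ladder (R := Module.End ℂ testFn) ((b : ℂ) / 4) h00 h01 h10 h11 partialOp_comm coordOp_comm
  have m0 : momentum b 0 = -(Complex.I • partialOp 0) + (2 * ((b : ℂ) / 4)) • coordOp 1 := by
    change -(Complex.I • partialOp 0) - -(((b : ℂ) / 2) • coordOp 1) = _
    match_scalars <;> ring
  have m1 : momentum b 1 = -(Complex.I • partialOp 1) - (2 * ((b : ℂ) / 4)) • coordOp 0 := by
    change -(Complex.I • partialOp 1) - ((b : ℂ) / 2) • coordOp 0 = _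
    match_scalars <;> ring
  have : -Complex.I * -Complex.I = -1 := by rw [neg_mul_neg, Complex.I_mul_I]
  rw [landau, m0, m1, h, annihilation_eq, creation_eq, smul_mul_smul_comm, this,
    show (b : ℂ) / 4 + b / 4 = b / 2 by ring, show 4 * ((b : ℂ) / 4) = b by ring]

theorem landau_apply (b : ℝ) (f : testFn) :
    landau b f = creation b (annihilation b f) + (b : ℂ) • f := by
  rw [landau_eq]; rfl

theorem annihilation_creation_apply (b : ℝ) (f : testFn) :
    annihilation b (creation b f) = creation b (annihilation b f) + (2 * b : ℂ) • f :=
  LinearMap.congr_fun (annihilation_mul_creation b) f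

/-! ### Graphs of closed operators -/

/-- A formal adjoint makes `D` closable, so the graph of the closure is the closure of the graph.
Identities and estimates on test functions thereby pass to closed operators along sequences. -/
theorem mem_graph_closedOp {D D' : Module.End ℂ testFn} (h : IsFormalAdj D D') {u v : L2} :
    (u, v) ∈ (closedOp D).graph ↔
      ∃ f : ℕ → testFn, Tendsto (fun n => toL2 (f n)) atTop (𝓝 u) ∧
        Tendsto (fun n => toL2 (D (f n))) atTop (𝓝 v) := by
  rw [closedOp, ← h.isClosable.graph_closure_eq_closure_graph, ← SetLike.mem_coe,
    Submodule.topologicalClosure_coe, mem_closure_iff_seq_limit]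
  constructor
  · rintro ⟨s, hs, hlim⟩
    have : ∀ n, ∃ f : testFn, s n = (toL2 f, toL2 (D f)) := by
      intro n
      obtain ⟨⟨y, f, rfl⟩, h1, h2⟩ := (LinearPMap.mem_graph_iff _).1 (hs n)
      exact ⟨f, Prod.ext h1.symm (h2.symm.trans (minimalOp_toL2 D f _))⟩
    choose f hf using this
    rw [Prod.tendsto_iff] at hlim
    simp only [hf] at hlim
    exact ⟨f, hlim⟩
  · rintro ⟨f, h1, h2⟩
    refine ⟨fun n => (toL2 (f n), toL2 (D (f n))), fun n => ?_, h1.prodMk_nhds h2⟩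
    exact (LinearPMap.mem_graph_iff _).2 ⟨⟨toL2 (f n), f n, rfl⟩, rfl, minimalOp_toL2 D _ _⟩

theorem mem_graph_closedOp_toL2 {D D' : Module.End ℂ testFn} (h : IsFormalAdj D D') (f : testFn) :
    (toL2 f, toL2 (D f)) ∈ (closedOp D).graph :=
  (mem_graph_closedOp h).2 ⟨fun _ => f, tendsto_const_nhds, tendsto_const_nhds⟩

/-- `u` is in the domain of the closed annihilation operator, which sends it to `v`. -/
def Ann (b : ℝ) (u v : L2) : Prop := (u, v) ∈ (opA b).graph

/-- `u` is in the domain of the closed creation operator, which sends it to `v`. -/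
def Cre (b : ℝ) (u v : L2) : Prop := (u, v) ∈ (opAstar b).graph

theorem ann_iff {u v : L2} : Ann b u v ↔
      ∃ f : ℕ → testFn, Tendsto (fun n => toL2 (f n)) atTop (𝓝 u) ∧
        Tendsto (fun n => toL2 (annihilation b (f n))) atTop (𝓝 v) :=
  mem_graph_closedOp (isFormalAdj_annihilation_creation b)

theorem cre_iff {u v : L2} : Cre b u v ↔
      ∃ f : ℕ → testFn, Tendsto (fun n => toL2 (f n)) atTop (𝓝 u) ∧
        Tendsto (fun n => toL2 (creation b (f n))) atTop (𝓝 v) :=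
  mem_graph_closedOp (isFormalAdj_annihilation_creation b).symm

theorem ann_toL2 (f : testFn) : Ann b (toL2 f) (toL2 (annihilation b f)) :=
  mem_graph_closedOp_toL2 (isFormalAdj_annihilation_creation b) f

theorem cre_toL2 (f : testFn) : Cre b (toL2 f) (toL2 (creation b f)) :=
  mem_graph_closedOp_toL2 (isFormalAdj_annihilation_creation b).symm f

theorem Ann.unique {u v w : L2} (h : Ann b u v) (h' : Ann b u w) : v = w :=
  LinearPMap.mem_graph_snd_inj' _ h h' rfl

theorem Cre.unique {u v w : L2} (h : Cre b u v) (h' : Cre b u w) : v = w :=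
  LinearPMap.mem_graph_snd_inj' _ h h' rfl

theorem Ann.add {u v u' v' : L2} (h : Ann b u v) (h' : Ann b u' v') : Ann b (u + u') (v + v') :=
  (opA b).graph.add_mem h h'

theorem Cre.add {u v u' v' : L2} (h : Cre b u v) (h' : Cre b u' v') : Cre b (u + u') (v + v') :=
  (opAstar b).graph.add_mem h h'

theorem Ann.smul {u v : L2} (c : ℂ) (h : Ann b u v) : Ann b (c • u) (c • v) :=
  (opA b).graph.smul_mem c h

theorem Cre.smul {u v : L2} (c : ℂ) (h : Cre b u v) : Cre b (c • u) (c • v) :=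
  (opAstar b).graph.smul_mem c h

theorem Ann.inner_eq {u v u' v' : L2} (h : Ann b u v) (h' : Cre b u' v') :
    inner ℂ v u' = inner ℂ u v' := by
  obtain ⟨f, hf, hf'⟩ := ann_iff.1 h
  obtain ⟨g, hg, hg'⟩ := cre_iff.1 h'
  refine tendsto_nhds_unique (hf'.inner hg) ?_
  simp_rw [isFormalAdj_annihilation_creation b _ _]
  exact hf.inner hg'

theorem Cre.inner_eq {u v u' v' : L2} (h : Cre b u v) (h' : Ann b u' v') :
    inner ℂ v u' = inner ℂ u v' := by
  rw [← inner_conj_symm, ← h'.inner_eq h, inner_conj_symm]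

theorem mem_graph_H0 {u h : L2} : (u, h) ∈ (H0 b).graph ↔
      ∃ f : ℕ → testFn, Tendsto (fun n => toL2 (f n)) atTop (𝓝 u) ∧
        Tendsto (fun n => toL2 (landau b (f n))) atTop (𝓝 h) :=
  mem_graph_closedOp (isFormalAdj_landau b)

theorem norm_sq_annihilation (f : testFn) : (‖toL2 (annihilation b f)‖ : ℂ) ^ 2 =
    inner ℂ (toL2 f) (toL2 (creation b (annihilation b f))) := by
  rw [← isFormalAdj_annihilation_creation b f]
  exact (inner_self_eq_norm_sq_to_K (𝕜 := ℂ) (E := L2) _).symm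

theorem norm_sq_creation (f : testFn) : (‖toL2 (creation b f)‖ : ℂ) ^ 2 =
    inner ℂ (toL2 f) (toL2 (annihilation b (creation b f))) := by
  rw [← (isFormalAdj_annihilation_creation b).symm f]
  exact (inner_self_eq_norm_sq_to_K (𝕜 := ℂ) (E := L2) _).symm

theorem norm_sq_creation_eq (f : testFn) : ‖toL2 (creation b f)‖ ^ 2 =
    ‖toL2 (annihilation b f)‖ ^ 2 + 2 * b * ‖toL2 f‖ ^ 2 := by
  have h := norm_sq_creation (b := b) f
  rw [annihilation_creation_apply, map_add, inner_add_right, ← norm_sq_annihilation, map_smul,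
    inner_smul_right, inner_self_eq_norm_sq_to_K] at h
  apply Complex.ofReal_injective
  push_cast
  exact h

theorem norm_sq_annihilation_le (f : testFn) : ‖toL2 (annihilation b f)‖ ^ 2 ≤
    ‖toL2 f‖ * ‖toL2 (creation b (annihilation b f))‖ := by
  have h := congrArg norm (norm_sq_annihilation (b := b) f)
  rw [norm_pow, Complex.norm_real, norm_norm] at h
  rw [h]
  exact norm_inner_le_norm _ _

/-- If `‖K g‖ ≤ ‖K₁ g‖ + c ‖K₂ g‖` on test functions and the sequences `K₁ f_n`, `K₂ f_n` are Cauchy,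
then so is `K f_n`. -/
theorem cauchySeq_of_sq_le {K K₁ K₂ : Module.End ℂ testFn} {c : ℝ} (hc : 0 ≤ c)
    (h : ∀ g, ‖toL2 (K g)‖ ^ 2 ≤ (‖toL2 (K₁ g)‖ + c * ‖toL2 (K₂ g)‖) ^ 2) {f : ℕ → testFn}
    (h1 : CauchySeq fun n => toL2 (K₁ (f n))) (h2 : CauchySeq fun n => toL2 (K₂ (f n))) :
    CauchySeq fun n => toL2 (K (f n)) := by
  rw [Metric.cauchySeq_iff] at *
  intro ε hε
  obtain ⟨N1, hN1⟩ := h1 (ε / 2) (by positivity)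
  obtain ⟨N2, hN2⟩ := h2 (ε / (2 * (c + 1))) (by positivity)
  refine ⟨max N1 N2, fun m hm n hn => ?_⟩
  have e1 := hN1 m (le_trans (le_max_left _ _) hm) n (le_trans (le_max_left _ _) hn)
  have e2 := hN2 m (le_trans (le_max_right _ _) hm) n (le_trans (le_max_right _ _) hn)
  rw [dist_eq_norm, ← map_sub, ← map_sub] at *
  have e3 := abs_le_of_sq_le_sq (h (f m - f n)) (by positivity)
  rw [abs_of_nonneg (norm_nonneg _)] at e3
  have e4 : c * ‖toL2 (K₂ (f m - f n))‖ ≤ c * (ε / (2 * (c + 1))) :=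
    mul_le_mul_of_nonneg_left e2.le hc
  have e5 : c * (ε / (2 * (c + 1))) ≤ ε / 2 := by
    rw [mul_div_assoc', div_le_div_iff₀ (by positivity) (by positivity)]
    nlinarith
  linarith

/-- The graph norm of `H₀` controls all words of length at most two in `a` and `a*`. Indeed `a* a =
H₀ - b`, `a a* = H₀ + b`, `‖a f‖² ≤ ‖f‖ ‖a* a f‖` and `‖a* f‖² = ‖a f‖² + 2b ‖f‖²`; the last
identity, applied to `a f` and to `a* f`, bounds `a a f` and `a* a* f`. One approximating sequence
therefore serves for all the words. -/
theorem exists_ann_cre_of_mem_graph_H0 (hb : 0 < b) {u h : L2} (huh : (u, h) ∈ (H0 b).graph) :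
    ∃ v v' w w' : L2, Ann b u v ∧ Cre b v (h - (b : ℂ) • u) ∧ Ann b v w ∧
      Cre b u v' ∧ Ann b v' (h + (b : ℂ) • u) ∧ Cre b v' w' := by
  obtain ⟨f, hf, hH⟩ := mem_graph_H0.1 huh
  have hca : Tendsto (fun n => toL2 (creation b (annihilation b (f n)))) atTop
      (𝓝 (h - (b : ℂ) • u)) := by
    have := hH.sub (hf.const_smul (b : ℂ))
    simpa [landau_apply] using this
  have hac : Tendsto (fun n => toL2 (annihilation b (creation b (f n)))) atTop
      (𝓝 (h + (b : ℂ) • u)) := by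
    have := hca.add (hf.const_smul (2 * b : ℂ))
    simp_rw [annihilation_creation_apply, map_add, map_smul]
    convert this using 2
    module
  have c1 : CauchySeq fun n => toL2 (annihilation b (f n)) := by
    refine cauchySeq_of_sq_le (K := annihilation b) (K₁ := 1)
      (K₂ := creation b * annihilation b) (c := 1) (by simp) (fun g => ?_) hf.cauchySeq
      hca.cauchySeq
    have := norm_sq_annihilation_le (b := b) g
    change _ ≤ (‖toL2 g‖ + 1 * ‖toL2 (creation b (annihilation b g))‖) ^ 2
    nlinarith [norm_nonneg (toL2 g), norm_nonneg (toL2 (creation b (annihilation b g)))]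
  have c2 : CauchySeq fun n => toL2 (creation b (f n)) := by
    -- Any constant `c ≥ 0` with `c² ≥ 2b` would do; `2b + 1` avoids a square root.
    refine cauchySeq_of_sq_le (K := creation b) (K₁ := annihilation b)
      (K₂ := 1) (c := 2 * b + 1) (by linarith) (fun g => ?_) c1 hf.cauchySeq
    rw [norm_sq_creation_eq]
    change _ ≤ (_ + (2 * b + 1) * ‖toL2 g‖) ^ 2
    nlinarith [norm_nonneg (toL2 g), norm_nonneg (toL2 (annihilation b g)),
      mul_nonneg (norm_nonneg (toL2 g)) (norm_nonneg (toL2 (annihilation b g))),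
      mul_nonneg hb.le (mul_nonneg (norm_nonneg (toL2 g)) (norm_nonneg (toL2 (annihilation b g)))),
      mul_nonneg hb.le (sq_nonneg ‖toL2 g‖), sq_nonneg (b * ‖toL2 g‖), sq_nonneg ‖toL2 g‖]
  have c3 : CauchySeq fun n => toL2 (annihilation b (annihilation b (f n))) := by
    refine cauchySeq_of_sq_le (K := annihilation b * annihilation b)
      (K₁ := creation b * annihilation b) (K₂ := 1) (c := 0) le_rfl (fun g => ?_) hca.cauchySeq
      hf.cauchySeq
    have := norm_sq_creation_eq (b := b) (annihilation b g)
    change ‖toL2 (annihilation b (annihilation b g))‖ ^ 2 ≤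
      (‖toL2 (creation b (annihilation b g))‖ + 0 * _) ^ 2
    rw [zero_mul, add_zero, this]
    have : 0 ≤ 2 * b * ‖toL2 (annihilation b g)‖ ^ 2 := by positivity
    linarith
  have c4 : CauchySeq fun n => toL2 (creation b (creation b (f n))) := by
    refine cauchySeq_of_sq_le (K := creation b * creation b)
      (K₁ := annihilation b * creation b) (K₂ := creation b) (c := 2 * b + 1) (by linarith)
      (fun g => ?_) hac.cauchySeq c2
    have := norm_sq_creation_eq (b := b) (creation b g)
    change ‖toL2 (creation b (creation b g))‖ ^ 2 ≤
      (‖toL2 (annihilation b (creation b g))‖ + _ * ‖toL2 (creation b g)‖) ^ 2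
    rw [this]
    generalize creation b g = g'
    nlinarith [norm_nonneg (toL2 g'), norm_nonneg (toL2 (annihilation b g')),
      mul_nonneg (norm_nonneg (toL2 g')) (norm_nonneg (toL2 (annihilation b g'))),
      mul_nonneg hb.le (mul_nonneg (norm_nonneg (toL2 g'))
        (norm_nonneg (toL2 (annihilation b g')))),
      mul_nonneg hb.le (sq_nonneg ‖toL2 g'‖), sq_nonneg (b * ‖toL2 g'‖), sq_nonneg ‖toL2 g'‖]
  obtain ⟨v, hv⟩ := cauchySeq_tendsto_of_complete c1
  obtain ⟨v', hv'⟩ := cauchySeq_tendsto_of_complete c2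
  obtain ⟨w, hw⟩ := cauchySeq_tendsto_of_complete c3
  obtain ⟨w', hw'⟩ := cauchySeq_tendsto_of_complete c4
  exact ⟨v, v', w, w', ann_iff.2 ⟨f, hf, hv⟩, cre_iff.2 ⟨_, hv, hca⟩, ann_iff.2 ⟨_, hv, hw⟩,
    cre_iff.2 ⟨f, hf, hv'⟩, ann_iff.2 ⟨_, hv', hac⟩, cre_iff.2 ⟨_, hv', hw'⟩⟩

/-! ### Multiplication of test functions by smooth functions -/

/-- The product of a smooth function and a test function. -/
def mulTest (w : Plane → ℂ) (hw : ContDiff ℝ ∞ w) (f : testFn) : testFn :=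
  ⟨fun x => w x * f.1 x, hw.mul f.2.1, f.2.2.mul_left⟩

theorem contDiff_dz {f : Plane → ℂ} (hf : ContDiff ℝ ∞ f) : ContDiff ℝ ∞ (dz f) :=
  contDiff_const.mul ((contDiff_pderiv hf 0).sub (contDiff_const.mul (contDiff_pderiv hf 1)))

theorem contDiff_dzbar {f : Plane → ℂ} (hf : ContDiff ℝ ∞ f) : ContDiff ℝ ∞ (dzbar f) :=
  contDiff_const.mul ((contDiff_pderiv hf 0).add (contDiff_const.mul (contDiff_pderiv hf 1)))

theorem annihilation_apply (f : testFn) (x : Plane) : (annihilation b f).1 x =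
    -2 * Complex.I * (dzbar f.1 x + b / 4 * (x 0 * f.1 x + Complex.I * (x 1 * f.1 x))) := rfl

theorem creation_apply (f : testFn) (x : Plane) : (creation b f).1 x =
    -2 * Complex.I * (dz f.1 x - b / 4 * (x 0 * f.1 x - Complex.I * (x 1 * f.1 x))) := rfl

theorem dz_mul {f g : Plane → ℂ} {x : Plane} (hf : DifferentiableAt ℝ f x)
    (hg : DifferentiableAt ℝ g x) :
    dz (fun y => f y * g y) x = dz f x * g x + f x * dz g x := by
  simp only [dz, pderiv_mul hf hg]
  ring

theorem dzbar_mul {f g : Plane → ℂ} {x : Plane} (hf : DifferentiableAt ℝ f x)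
    (hg : DifferentiableAt ℝ g x) :
    dzbar (fun y => f y * g y) x = dzbar f x * g x + f x * dzbar g x := by
  simp only [dzbar, pderiv_mul hf hg]
  ring

theorem annihilation_mulTest {w : Plane → ℂ} (hw : ContDiff ℝ ∞ w) (f : testFn) :
    annihilation b (mulTest w hw f) = mulTest w hw (annihilation b f) +
      (-2 * Complex.I) • mulTest (dzbar w) (contDiff_dzbar hw) f := by
  ext x
  have := dzbar_mul (hw.differentiable (by simp) x) (f.2.1.differentiable (by simp) x)
  change (annihilation b (mulTest w hw f)).1 x = w x * (annihilation b f).1 x +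
    (-2 * Complex.I) * (dzbar w x * f.1 x)
  rw [annihilation_apply, annihilation_apply]
  change -2 * Complex.I * (dzbar (fun y => w y * f.1 y) x +
    b / 4 * (x 0 * (w x * f.1 x) + Complex.I * (x 1 * (w x * f.1 x)))) = _
  rw [this]
  ring

theorem creation_mulTest {w : Plane → ℂ} (hw : ContDiff ℝ ∞ w) (f : testFn) :
    creation b (mulTest w hw f) = mulTest w hw (creation b f) +
      (-2 * Complex.I) • mulTest (dz w) (contDiff_dz hw) f := by
  ext x
  have := dz_mul (hw.differentiable (by simp) x) (f.2.1.differentiable (by simp) x)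
  change (creation b (mulTest w hw f)).1 x = w x * (creation b f).1 x +
    (-2 * Complex.I) * (dz w x * f.1 x)
  rw [creation_apply, creation_apply]
  change -2 * Complex.I * (dz (fun y => w y * f.1 y) x -
    b / 4 * (x 0 * (w x * f.1 x) - Complex.I * (x 1 * (w x * f.1 x)))) = _
  rw [this]
  ring

/-! ### Completeness of monomials times a rapidly decaying function -/

/-- The complex coordinate `z = x₁ + i x₂`. -/
def zf (x : Plane) : ℂ := x 0 + Complex.I * x 1

/-- The complex coordinate `z̄ = x₁ - i x₂`. -/
def zbf (x : Plane) : ℂ := x 0 - Complex.I * x 1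

theorem continuous_zf : Continuous zf := by unfold zf; fun_prop

theorem continuous_zbf : Continuous zbf := by unfold zbf; fun_prop

theorem conj_zf (x : Plane) : conj (zf x) = zbf x := by
  simp [zf, zbf, sub_eq_add_neg]

theorem zf_mul_zbf (x : Plane) : zf x * zbf x = (‖x‖ : ℂ) ^ 2 := by
  have h : ‖x‖ ^ 2 = x 0 ^ 2 + x 1 ^ 2 := by
    rw [EuclideanSpace.norm_sq_eq]
    simp
  have h' : (‖x‖ : ℂ) ^ 2 = (x 0 : ℂ) ^ 2 + (x 1 : ℂ) ^ 2 := by exact_mod_cast h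
  rw [h', zf, zbf]
  linear_combination -(x 1 : ℂ) ^ 2 * Complex.I_sq

theorem norm_zf (x : Plane) : ‖zf x‖ = ‖x‖ := by
  have h := congrArg norm (zf_mul_zbf x)
  rw [norm_mul, ← conj_zf, RCLike.norm_conj, norm_pow, Complex.norm_real, norm_norm] at h
  nlinarith [norm_nonneg (zf x), norm_nonneg x]

theorem norm_zbf (x : Plane) : ‖zbf x‖ = ‖x‖ := by
  rw [← conj_zf, RCLike.norm_conj, norm_zf]

theorem inner_eq_zf_zbf (ξ x : Plane) : ((inner ℝ x ξ : ℝ) : ℂ) =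
    zbf ξ / 2 * zf x + zf ξ / 2 * zbf x := by
  simp only [PiLp.inner_apply, Fin.sum_univ_two, zf, zbf]
  simp
  linear_combination (ξ 1 : ℂ) * (x 1 : ℂ) * Complex.I_sq

theorem pow_le_factorial_mul_exp {t : ℝ} (ht : 0 ≤ t) (n : ℕ) :
    t ^ n ≤ n.factorial * Real.exp t := by
  have := Real.pow_div_factorial_le_exp t ht n
  rwa [div_le_iff₀' (by positivity)] at this

theorem integrable_mul_monomial {F : Plane → ℂ} (hF : AEStronglyMeasurable F volume)
    (hexp : ∀ c : ℝ, Integrable (fun x => Real.exp (c * ‖x‖) * ‖F x‖) (volume : Measure Plane))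
    (k l : ℕ) :
    Integrable (fun x => F x * (zf x ^ k * zbf x ^ l)) (volume : Measure Plane) := by
  refine ((hexp 1).const_mul ((k + l).factorial : ℝ)).mono'
    (hF.mul ((continuous_zf.pow k).mul (continuous_zbf.pow l)).aestronglyMeasurable)
    (Eventually.of_forall fun x => ?_)
  rw [norm_mul, norm_mul, norm_pow, norm_pow, norm_zf, norm_zbf, ← pow_add, one_mul]
  have := mul_le_mul_of_nonneg_left (pow_le_factorial_mul_exp (norm_nonneg x) (k + l))
    (norm_nonneg (F x))
  linarith

theorem integral_mul_inner_pow {F : Plane → ℂ} (hF : AEStronglyMeasurable F volume)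
    (hexp : ∀ c : ℝ, Integrable (fun x => Real.exp (c * ‖x‖) * ‖F x‖) (volume : Measure Plane))
    (hm : ∀ k l : ℕ, ∫ x, F x * (zf x ^ k * zbf x ^ l) = 0)
    (ξ : Plane) (n : ℕ) :
    ∫ x, F x * ((inner ℝ x ξ : ℝ) : ℂ) ^ n = 0 := by
  have : ∀ x, F x * ((inner ℝ x ξ : ℝ) : ℂ) ^ n = ∑ m ∈ Finset.range (n + 1),
      ((zbf ξ / 2) ^ m * (zf ξ / 2) ^ (n - m) * n.choose m) *
        (F x * (zf x ^ m * zbf x ^ (n - m))) := by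
    intro x
    rw [inner_eq_zf_zbf, add_pow, Finset.mul_sum]
    refine Finset.sum_congr rfl fun m _ => ?_
    rw [mul_pow, mul_pow]
    ring
  simp_rw [this]
  rw [integral_finsetSum _ fun m _ => (integrable_mul_monomial hF hexp _ _).const_mul _]
  simp_rw [integral_const_mul, hm, mul_zero, Finset.sum_const_zero]

open scoped FourierTransform in
-- Expand the exponential kernel in its power series and integrate term by term: each term is a
-- combination of moments. The exponential integrability of `F` dominates the partial sums.
theorem fourier_eq_zero_of_moments {F : Plane → ℂ} (hF : AEStronglyMeasurable F volume)
    (hexp : ∀ c : ℝ, Integrable (fun x => Real.exp (c * ‖x‖) * ‖F x‖) (volume : Measure Plane))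
    (hm : ∀ k l : ℕ, ∫ x, F x * (zf x ^ k * zbf x ^ l) = 0)
    (ξ : Plane) : 𝓕 F ξ = 0 := by
  rw [Real.fourier_eq']
  set c : ℂ := -2 * Real.pi * Complex.I with hc
  have hs := hasSum_integral_of_dominated_convergence (μ := (volume : Measure Plane))
    (F := fun (n : ℕ) x => (c * ((inner ℝ x ξ : ℝ) : ℂ)) ^ n / n.factorial * F x)
    (f := fun x => Complex.exp (c * ((inner ℝ x ξ : ℝ) : ℂ)) * F x)
    (fun n x => (‖c‖ * ‖ξ‖ * ‖x‖) ^ n / n.factorial * ‖F x‖) ?_ ?_ ?_ ?_ ?_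
  · have h0 : ∀ n : ℕ, ∫ x, (c * ((inner ℝ x ξ : ℝ) : ℂ)) ^ n / n.factorial * F x = 0 := by
      intro n
      have : ∀ x, (c * ((inner ℝ x ξ : ℝ) : ℂ)) ^ n / n.factorial * F x =
          c ^ n / n.factorial * (F x * ((inner ℝ x ξ : ℝ) : ℂ) ^ n) := by
        intro x
        rw [mul_pow]
        ring
      simp_rw [this]
      rw [integral_const_mul, integral_mul_inner_pow hF hexp hm, mul_zero]
    simp_rw [h0] at hs
    rw [← hs.unique hasSum_zero]
    congr 1
    ext x
    rw [smul_eq_mul, hc]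
    congr 2
    push_cast
    ring
  · intro n
    refine AEStronglyMeasurable.mul (Continuous.aestronglyMeasurable ?_) hF
    fun_prop
  · intro n
    refine Eventually.of_forall fun x => ?_
    rw [norm_mul, norm_div, norm_pow, norm_mul, Complex.norm_real, Complex.norm_natCast]
    have hle : ‖c‖ * ‖(inner ℝ x ξ : ℝ)‖ ≤ ‖c‖ * ‖ξ‖ * ‖x‖ := by
      rw [mul_assoc, mul_comm ‖ξ‖]
      exact mul_le_mul_of_nonneg_left (norm_inner_le_norm x ξ) (norm_nonneg c)
    gcongr
  · exact Eventually.of_forall fun x => (Real.summable_pow_div_factorial _).mul_right _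
  · refine (hexp (‖c‖ * ‖ξ‖)).congr (Eventually.of_forall fun x => ?_)
    change _ = ∑' n : ℕ, (‖c‖ * ‖ξ‖ * ‖x‖) ^ n / n.factorial * ‖F x‖
    rw [tsum_mul_right, Real.exp_eq_exp_ℝ, NormedSpace.exp_eq_tsum_div]
  · refine Eventually.of_forall fun x => ?_
    refine HasSum.mul_right (F x) ?_
    rw [Complex.exp_eq_exp_ℂ]
    exact NormedSpace.expSeries_div_hasSum_exp _

open scoped FourierTransform in
/-- A function of rapid decay all of whose moments vanish is zero. -/
theorem ae_eq_zero_of_moments {F : Plane → ℂ} (hF : AEStronglyMeasurable F volume)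
    (hexp : ∀ c : ℝ, Integrable (fun x => Real.exp (c * ‖x‖) * ‖F x‖) (volume : Measure Plane))
    (hm : ∀ k l : ℕ, ∫ x, F x * (zf x ^ k * zbf x ^ l) = 0) : F =ᵐ[volume] 0 := by
  have hint : Integrable F (volume : Measure Plane) := by
    simpa using integrable_mul_monomial hF hexp 0 0
  refine ae_eq_zero_of_integral_contDiff_smul_eq_zero hint.locallyIntegrable fun g hg hc => ?_
  have hgc : HasCompactSupport fun x => (g x : ℂ) :=
    hc.comp_left (g := fun t : ℝ => (t : ℂ)) Complex.ofReal_zero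
  let φ : SchwartzMap Plane ℂ := hgc.toSchwartzMap (Complex.ofRealCLM.contDiff.comp hg)
  -- Since `φ` is the Fourier transform of `ψ`, the pairing of `F` with `φ` equals that of `𝓕 F = 0`
  -- with `ψ`.
  let ψ : SchwartzMap Plane ℂ := 𝓕⁻ φ
  have hφ : 𝓕 (ψ : Plane → ℂ) = φ := by
    rw [← SchwartzMap.fourier_coe]
    exact congrArg _ (FourierTransform.fourier_fourierInv_eq φ)
  have key := VectorFourier.integral_fourierIntegral_smul_eq_flip (L := innerₗ Plane)
    (μ := (volume : Measure Plane)) (ν := (volume : Measure Plane)) (f := F) (g := (ψ : Plane → ℂ))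
    Real.continuous_fourierChar continuous_inner hint ψ.integrable
  have e1 : ∀ ξ, VectorFourier.fourierIntegral Real.fourierChar volume (innerₗ Plane) F ξ = 0 :=
    fun ξ => fourier_eq_zero_of_moments hF hexp hm ξ
  have e2 : VectorFourier.fourierIntegral Real.fourierChar volume (innerₗ Plane).flip (ψ : Plane → ℂ)
      = φ := by
    rw [flip_innerₗ]
    exact hφ
  simp_rw [e1, zero_smul, integral_zero, e2] at key
  rw [key]
  congr 1
  ext x
  change g x • F x = F x • (g x : ℂ)
  rw [Complex.real_smul, smul_eq_mul, mul_comm]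

/-! ### Gaussian bounds -/

theorem memLp_exp_norm_sub_sq {β : ℝ} (hβ : 0 < β) (c : ℝ) :
    MemLp (fun x : Plane => Real.exp (c * ‖x‖ - β * ‖x‖ ^ 2)) 2 (volume : Measure Plane) := by
  have hcont : Continuous fun x : Plane => Real.exp (c * ‖x‖ - β * ‖x‖ ^ 2) := by fun_prop
  rw [memLp_two_iff_integrable_sq hcont.aestronglyMeasurable]
  have hg := (GaussianFourier.integrable_cexp_neg_mul_sq_norm_add (b := (β : ℂ)) (V := Plane)
    (by simpa using hβ) 0 0).norm
  refine (hg.const_mul (Real.exp (c ^ 2 / β))).mono' (hcont.pow 2).aestronglyMeasurable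
    (Eventually.of_forall fun x => ?_)
  rw [Real.norm_of_nonneg (by positivity), Complex.norm_exp, ← Real.exp_nat_mul, ← Real.exp_add,
    Real.exp_le_exp]
  have : (-(β : ℂ) * (‖x‖ : ℂ) ^ 2 + 0 * ((inner ℝ (0 : Plane) x : ℝ) : ℂ)).re =
      -β * ‖x‖ ^ 2 := by
    rw [zero_mul, add_zero, ← Complex.ofReal_pow, ← Complex.ofReal_neg, ← Complex.ofReal_mul,
      Complex.ofReal_re]
  rw [this]
  -- Completing the square bounds the squared function by a constant times a Gaussian of half the
  -- decay rate.
  have h1 : c ^ 2 / β + -β * ‖x‖ ^ 2 - (2 : ℕ) * (c * ‖x‖ - β * ‖x‖ ^ 2) =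
      (c - β * ‖x‖) ^ 2 / β := by
    field_simp
    push_cast
    ring
  have h2 : 0 ≤ (c - β * ‖x‖) ^ 2 / β := by positivity
  linarith

/-! ### Gaussian monomials -/

theorem pderiv_pow {j : Fin 2} {f : Plane → ℂ} {x : Plane} (hf : DifferentiableAt ℝ f x) (k : ℕ) :
    pderiv j (fun y => f y ^ k) x = k * f x ^ (k - 1) * pderiv j f x := by
  unfold pderiv
  rw [fderiv_fun_pow k hf]
  simp

theorem pderiv_cexp {j : Fin 2} {f : Plane → ℂ} {x : Plane} (hf : DifferentiableAt ℝ f x) :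
    pderiv j (fun y => Complex.exp (f y)) x = Complex.exp (f x) * pderiv j f x := by
  unfold pderiv
  rw [hf.hasFDerivAt.cexp.fderiv]
  simp

theorem contDiff_zf : ContDiff ℝ ∞ zf :=
  (contDiff_coord 0).add (contDiff_const.mul (contDiff_coord 1))

theorem contDiff_zbf : ContDiff ℝ ∞ zbf :=
  (contDiff_coord 0).sub (contDiff_const.mul (contDiff_coord 1))

theorem pderiv_coord_add (c : ℂ) (j : Fin 2) (x : Plane) :
    pderiv j (fun y : Plane => (y 0 : ℂ) + c * (y 1 : ℂ)) x = if j = 0 then 1 else c := by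
  have h0 := ((contDiff_coord 0).differentiable (by simp) x).hasFDerivAt
  have h1 := ((contDiff_coord 1).differentiable (by simp) x).hasFDerivAt
  have e0 := pderiv_coord j 0 x
  have e1 := pderiv_coord j 1 x
  have h := (h0.add (h1.const_mul c)).fderiv
  unfold pderiv at *
  change fderiv ℝ ((fun y : Plane => (y 0 : ℂ)) + fun y : Plane => c * (y 1 : ℂ)) x _ = _
  rw [h, add_apply, smul_apply, e0, e1]
  fin_cases j <;> simp

theorem pderiv_zf (j : Fin 2) (x : Plane) : pderiv j zf x = if j = 0 then 1 else Complex.I :=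
  pderiv_coord_add Complex.I j x

theorem pderiv_zbf (j : Fin 2) (x : Plane) : pderiv j zbf x = if j = 0 then 1 else -Complex.I := by
  rw [← pderiv_coord_add (-Complex.I) j x]
  congr 1
  ext y
  rw [zbf]
  ring

/-- The function `z^k z̄^l exp (-b |z|² / 4)`. -/
def gaussMonomial (b : ℝ) (k l : ℕ) (x : Plane) : ℂ :=
  zf x ^ k * zbf x ^ l * Complex.exp (-(b / 4) * (zf x * zbf x))

theorem contDiff_gaussMonomial (k l : ℕ) : ContDiff ℝ ∞ (gaussMonomial b k l) :=
  ((contDiff_zf.pow k).mul (contDiff_zbf.pow l)).mul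
    ((contDiff_const.mul (contDiff_zf.mul contDiff_zbf)).cexp)

/-- The truncated exponents `k - 1` and `l - 1` are harmless: at `k = 0` or `l = 0` the coefficient
in front vanishes. -/
theorem pderiv_gaussMonomial (j : Fin 2) (k l : ℕ) (x : Plane) :
    pderiv j (gaussMonomial b k l) x =
      k * pderiv j zf x * gaussMonomial b (k - 1) l x
        + l * pderiv j zbf x * gaussMonomial b k (l - 1) x
        - b / 4 * (pderiv j zf x * zbf x + zf x * pderiv j zbf x) * gaussMonomial b k l x := by
  have hz : DifferentiableAt ℝ zf x := contDiff_zf.differentiable (by simp) x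
  have hw : DifferentiableAt ℝ zbf x := contDiff_zbf.differentiable (by simp) x
  -- The nested lambdas display the product structure in the form that the rewriting rules for
  -- `pderiv` match.
  have e : gaussMonomial b k l = fun y => (fun y => zf y ^ k * zbf y ^ l) y *
    (fun y => Complex.exp ((fun y => (fun _ => (-(b / 4) : ℂ)) y * (fun y => zf y * zbf y) y) y)) y :=
    rfl
  have hc : pderiv j (fun _ => (-(b / 4) : ℂ)) x = 0 := by simp [pderiv]
  rw [e, pderiv_mul (by fun_prop) (by fun_prop), pderiv_mul (by fun_prop) (by fun_prop),
    pderiv_cexp (by fun_prop), pderiv_mul (by fun_prop) (by fun_prop), pderiv_mul hz hw,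
    pderiv_pow hz, pderiv_pow hw, hc]
  simp only [gaussMonomial]
  ring

theorem dz_gaussMonomial (k l : ℕ) (x : Plane) : dz (gaussMonomial b k l) x =
    k * gaussMonomial b (k - 1) l x - b / 4 * zbf x * gaussMonomial b k l x := by
  rw [dz, pderiv_gaussMonomial, pderiv_gaussMonomial]
  simp only [pderiv_zf, pderiv_zbf, if_true, if_neg (one_ne_zero (α := Fin 2))]
  linear_combination (-(1 / 2) * k * gaussMonomial b (k - 1) l x
    + (1 / 2) * l * gaussMonomial b k (l - 1) x +
    (1 / 2) * (b / 4) * (zbf x - zf x) * gaussMonomial b k l x) * Complex.I_sq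

theorem dzbar_gaussMonomial (k l : ℕ) (x : Plane) : dzbar (gaussMonomial b k l) x =
    l * gaussMonomial b k (l - 1) x - b / 4 * zf x * gaussMonomial b k l x := by
  rw [dzbar, pderiv_gaussMonomial, pderiv_gaussMonomial]
  simp only [pderiv_zf, pderiv_zbf, if_true, if_neg (one_ne_zero (α := Fin 2))]
  linear_combination ((1 / 2) * k * gaussMonomial b (k - 1) l x
    - (1 / 2) * l * gaussMonomial b k (l - 1) x -
    (1 / 2) * (b / 4) * (zbf x - zf x) * gaussMonomial b k l x) * Complex.I_sq

theorem norm_gaussMonomial (k l : ℕ) (x : Plane) : ‖gaussMonomial b k l x‖ =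
    ‖x‖ ^ (k + l) * Real.exp (-(b / 4) * ‖x‖ ^ 2) := by
  have : -((b : ℂ) / 4) * (zf x * zbf x) = ((-(b / 4) * ‖x‖ ^ 2 : ℝ) : ℂ) := by
    rw [zf_mul_zbf]
    push_cast
    ring
  rw [gaussMonomial, this, norm_mul, norm_mul, norm_pow, norm_pow, norm_zf, norm_zbf, ← pow_add,
    Complex.norm_exp_ofReal]

theorem memLp_gaussMonomial (hb : 0 < b) (k l : ℕ) :
    MemLp (gaussMonomial b k l) 2 (volume : Measure Plane) := by
  refine MemLp.mono' ((memLp_exp_norm_sub_sq (β := b / 4) (by positivity) 1).const_mul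
    ((k + l).factorial : ℝ)) (contDiff_gaussMonomial k l).continuous.aestronglyMeasurable
    (Eventually.of_forall fun x => ?_)
  rw [norm_gaussMonomial, sub_eq_add_neg, Real.exp_add, ← mul_assoc, one_mul, ← neg_mul]
  exact mul_le_mul_of_nonneg_right (pow_le_factorial_mul_exp (norm_nonneg x) _) (Real.exp_pos _).le

/-- The product of a Gaussian monomial and a test function. -/
def gaussTest (b : ℝ) (k l : ℕ) (f : testFn) : testFn :=
  mulTest (gaussMonomial b k l) (contDiff_gaussMonomial k l) f

/-- The Gaussian is killed by `∂/∂z̄ + bz/4`, so on what multiplies it `a` acts as `-2i ∂/∂z̄`.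
Likewise `a*` acts there as `-2i (∂/∂z - b z̄/2)`, which is why it also raises `l`. -/
theorem annihilation_gaussTest (k l : ℕ) (f : testFn) : annihilation b (gaussTest b k l f) =
    (-2 * Complex.I) • (gaussTest b k l (dzbarOp f) + (l : ℂ) • gaussTest b k (l - 1) f) := by
  rw [gaussTest, annihilation_mulTest]
  ext x
  change gaussMonomial b k l x * (annihilation b f).1 x +
    (-2 * Complex.I) * (dzbar (gaussMonomial b k l) x * f.1 x) =
    (-2 * Complex.I) * (gaussMonomial b k l x * dzbar f.1 x +
      l * (gaussMonomial b k (l - 1) x * f.1 x))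
  rw [annihilation_apply, dzbar_gaussMonomial, zf]
  ring

theorem creation_gaussTest (k l : ℕ) (f : testFn) : creation b (gaussTest b k l f) =
    (-2 * Complex.I) • (gaussTest b k l (dzOp f) + (k : ℂ) • gaussTest b (k - 1) l f -
      ((b : ℂ) / 2) • gaussTest b k (l + 1) f) := by
  rw [gaussTest, creation_mulTest]
  ext x
  change gaussMonomial b k l x * (creation b f).1 x +
    (-2 * Complex.I) * (dz (gaussMonomial b k l) x * f.1 x) =
    (-2 * Complex.I) * (gaussMonomial b k l x * dz f.1 x +
      k * (gaussMonomial b (k - 1) l x * f.1 x) -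
      (b / 2) * (gaussMonomial b k (l + 1) x * f.1 x))
  have : gaussMonomial b k (l + 1) x = zbf x * gaussMonomial b k l x := by
    simp only [gaussMonomial]
    ring
  rw [creation_apply, dz_gaussMonomial, this, zbf]
  ring

/-! ### Dilations of test functions -/

/-- The test function `x ↦ f (c x)`. -/
def dilate (c : ℝ) (hc : c ≠ 0) (f : testFn) : testFn :=
  ⟨fun x => f.1 (c • x), f.2.1.comp (contDiff_const_smul c),
    f.2.2.comp_homeomorph (Homeomorph.smulOfNeZero c hc)⟩

theorem pderiv_dilate (c : ℝ) (hc : c ≠ 0) (f : testFn) (j : Fin 2) (x : Plane) :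
    pderiv j (dilate c hc f).1 x = c * pderiv j f.1 (c • x) := by
  have hf : HasFDerivAt f.1 (fderiv ℝ f.1 (c • x)) (c • x) :=
    (f.2.1.differentiable (by simp) _).hasFDerivAt
  have hl : HasFDerivAt (fun y : Plane => c • y) (c • ContinuousLinearMap.id ℝ Plane) x :=
    (c • ContinuousLinearMap.id ℝ Plane).hasFDerivAt
  have h := (hf.comp x hl).fderiv
  change fderiv ℝ (f.1 ∘ fun y : Plane => c • y) x _ = _
  rw [h]
  simp [pderiv]

theorem dzOp_dilate (c : ℝ) (hc : c ≠ 0) (f : testFn) :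
    dzOp (dilate c hc f) = (c : ℂ) • dilate c hc (dzOp f) := by
  ext x
  change dz (dilate c hc f).1 x = c * dz f.1 (c • x)
  rw [dz, dz, pderiv_dilate, pderiv_dilate]
  ring

theorem dzbarOp_dilate (c : ℝ) (hc : c ≠ 0) (f : testFn) :
    dzbarOp (dilate c hc f) = (c : ℂ) • dilate c hc (dzbarOp f) := by
  ext x
  change dzbar (dilate c hc f).1 x = c * dzbar f.1 (c • x)
  rw [dzbar, dzbar, pderiv_dilate, pderiv_dilate]
  ring

theorem gaussTest_smul (k l : ℕ) (c : ℂ) (f : testFn) :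
    gaussTest b k l (c • f) = c • gaussTest b k l f := by
  ext x
  exact mul_left_comm _ _ _

theorem inner_toL2_right (g : L2) (f : testFn) :
    inner ℂ g (toL2 f) = ∫ x, conj (g x) * f.1 x := by
  rw [L2.inner_def]
  refine integral_congr_ae ?_
  filter_upwards [MemLp.coeFn_toLp (memLp_testFn f)] with x hf
  change inner ℂ (g x) ((memLp_testFn f).toLp f.1 x) = _
  rw [hf]
  simp [mul_comm]

theorem integrable_conj_mul (g : L2) {h : Plane → ℂ} (hh : MemLp h 2 (volume : Measure Plane)) :
    Integrable (fun x => conj (g x) * h x) (volume : Measure Plane) :=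
  (Lp.memLp g).star.integrable_mul hh

theorem inv_succ_ne_zero (n : ℕ) : (1 / ((n : ℝ) + 1)) ≠ 0 := by positivity

/-- The functions `f(x/(n+1))` are uniformly bounded and tend pointwise to `f(0)`, so dominated
convergence removes the cut-off. -/
theorem tendsto_inner_gaussTest (hb : 0 < b) (g : L2) (k l : ℕ) (f : testFn) :
    Tendsto (fun n : ℕ => inner ℂ g (toL2 (gaussTest b k l
      (dilate (1 / ((n : ℝ) + 1)) (inv_succ_ne_zero n) f)))) atTop
      (𝓝 (f.1 0 * ∫ x, conj (g x) * gaussMonomial b k l x)) := by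
  simp_rw [inner_toL2_right]
  obtain ⟨C, hC⟩ := f.2.2.exists_bound_of_continuous f.2.1.continuous
  have hint := integrable_conj_mul g (memLp_gaussMonomial hb k l)
  rw [← integral_const_mul]
  refine tendsto_integral_of_dominated_convergence
    (fun x => ‖conj (g x) * gaussMonomial b k l x‖ * C) (fun n => ?_) (hint.norm.mul_const C)
    (fun n => Eventually.of_forall fun x => ?_) (Eventually.of_forall fun x => ?_)
  · exact (Lp.memLp g).star.1.mul (gaussTest b k l _).2.1.continuous.aestronglyMeasurable
  · change ‖conj (g x) * (gaussMonomial b k l x * f.1 _)‖ ≤ _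
    rw [← mul_assoc, norm_mul]
    exact mul_le_mul_of_nonneg_left (hC _) (norm_nonneg _)
  · change Tendsto (fun n : ℕ => conj (g x) * (gaussMonomial b k l x *
      f.1 ((1 / ((n : ℝ) + 1)) • x))) atTop _
    have h1 : Tendsto (fun n : ℕ => (1 / ((n : ℝ) + 1)) • x) atTop (𝓝 0) := by
      simpa using (tendsto_one_div_add_atTop_nhds_zero_nat (𝕜 := ℝ)).smul_const x
    have h2 := ((f.2.1.continuous.tendsto 0).comp h1).const_mul
      (conj (g x) * gaussMonomial b k l x)
    rw [mul_comm (f.1 0)]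
    refine h2.congr fun n => ?_
    rw [mul_assoc]
    rfl

/-- Without the cut-off this is the action of `a* a + b + 1` on `z^k z̄^l exp(-b|z|²/4)`: the
monomial is reproduced with factor `2bl + b + 1`, and `z^{k-1} z̄^{l-1}` appears with factor `-4kl`.
-/
theorem moment_recurrence (hb : 0 < b) {g : L2}
    (hg : ∀ f : testFn, inner ℂ g (toL2 (landau b f + f)) = 0) (k l : ℕ) :
    (2 * b * l + b + 1 : ℂ) * ∫ x, conj (g x) * gaussMonomial b k l x =
      4 * k * l * ∫ x, conj (g x) * gaussMonomial b (k - 1) (l - 1) x := by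
  let χ₀ : ContDiffBump (0 : Plane) := ⟨1, 2, one_pos, one_lt_two⟩
  let χ : testFn := ⟨fun x => (χ₀ x : ℂ), Complex.ofRealCLM.contDiff.comp χ₀.contDiff,
    χ₀.hasCompactSupport.comp_left (g := fun t : ℝ => (t : ℂ)) Complex.ofReal_zero⟩
  have hχ : χ.1 0 = 1 := by
    change ((χ₀ 0 : ℝ) : ℂ) = 1
    rw [χ₀.one_of_mem_closedBall (by simp [χ₀]), Complex.ofReal_one]
  let T : ℕ → ℕ → testFn → ℕ → ℂ := fun k l f n => inner ℂ g (toL2 (gaussTest b k l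
    (dilate (1 / ((n : ℝ) + 1)) (inv_succ_ne_zero n) f)))
  have hT : ∀ k l f, Tendsto (T k l f) atTop
      (𝓝 (f.1 0 * ∫ x, conj (g x) * gaussMonomial b k l x)) :=
    fun k l f => tendsto_inner_gaussTest hb g k l f
  let c : ℕ → ℂ := fun n => ((1 / ((n : ℝ) + 1) : ℝ) : ℂ)
  have hc : Tendsto c atTop (𝓝 0) := by
    have := (Complex.continuous_ofReal.tendsto 0).comp
      (tendsto_one_div_add_atTop_nhds_zero_nat (𝕜 := ℝ))
    rwa [Complex.ofReal_zero] at this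
  -- Each derivative that falls on the dilated cut-off brings a factor `c n`, which tends to zero.
  have key : ∀ n, -4 * (c n * (c n * T k l (dzOp (dzbarOp χ)) n
      + k * T (k - 1) l (dzbarOp χ) n - b / 2 * T k (l + 1) (dzbarOp χ) n)
      + l * (c n * T k (l - 1) (dzOp χ) n + k * T (k - 1) (l - 1) χ n
        - b / 2 * T k (l - 1 + 1) χ n)) + (b + 1) * T k l χ n = 0 := by
    intro n
    have h := hg (gaussTest b k l (dilate (1 / ((n : ℝ) + 1)) (inv_succ_ne_zero n) χ))
    rw [landau_apply, annihilation_gaussTest, dzbarOp_dilate, gaussTest_smul] at h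
    simp only [map_add, map_smul, map_sub, creation_gaussTest, dzOp_dilate, gaussTest_smul,
      inner_add_right, inner_sub_right, inner_smul_right] at h
    rw [← h]
    simp only [T, c]
    linear_combination (-4 * (c n * (c n * T k l (dzOp (dzbarOp χ)) n
      + k * T (k - 1) l (dzbarOp χ) n - b / 2 * T k (l + 1) (dzbarOp χ) n)
      + l * (c n * T k (l - 1) (dzOp χ) n + k * T (k - 1) (l - 1) χ n
        - b / 2 * T k (l - 1 + 1) χ n))) * Complex.I_sq
  have lim := ((((hc.mul (((hc.mul (hT k l (dzOp (dzbarOp χ)))).add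
      ((hT (k - 1) l (dzbarOp χ)).const_mul (k : ℂ))).sub
      ((hT k (l + 1) (dzbarOp χ)).const_mul ((b : ℂ) / 2)))).add
    ((((hc.mul (hT k (l - 1) (dzOp χ))).add
      ((hT (k - 1) (l - 1) χ).const_mul (k : ℂ))).sub
      ((hT k (l - 1 + 1) χ).const_mul ((b : ℂ) / 2))).const_mul (l : ℂ))).const_mul (-4 : ℂ)).add
    ((hT k l χ).const_mul ((b : ℂ) + 1)))
  have h0 := tendsto_nhds_unique (lim.congr key) tendsto_const_nhds
  rw [hχ] at h0
  -- The index `l - 1 + 1` is `l` only for positive `l`; at `l = 0` its term carries the factor `l`.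
  rcases l with _ | l
  · push_cast at *
    linear_combination h0
  · rw [Nat.add_sub_cancel] at *
    linear_combination h0

/-- Induction on `l` for all `k` at once: the factor `2bl + b + 1` is positive, and the right-hand
side of the recurrence vanishes at `l = 0`. -/
theorem moment_eq_zero (hb : 0 < b) {g : L2}
    (hg : ∀ f : testFn, inner ℂ g (toL2 (landau b f + f)) = 0) (k l : ℕ) :
    ∫ x, conj (g x) * gaussMonomial b k l x = 0 := by
  have hne : ∀ l : ℕ, (2 * b * l + b + 1 : ℂ) ≠ 0 := fun l => by
    have : (0 : ℝ) < 2 * b * l + b + 1 := by positivity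
    exact_mod_cast this.ne'
  induction l generalizing k with
  | zero =>
    have h := moment_recurrence hb hg k 0
    rw [Nat.cast_zero, mul_zero, mul_zero, zero_mul] at h
    exact (mul_eq_zero.1 h).resolve_left (by simpa using hne 0)
  | succ l ih =>
    have h := moment_recurrence hb hg k (l + 1)
    rw [Nat.add_sub_cancel, ih, mul_zero] at h
    exact (mul_eq_zero.1 h).resolve_left (hne (l + 1))

/-! ### Essential self-adjointness -/

/-- The function `ḡ exp(-b|z|²/4)` is integrable against every exponential and has zero moments,
hence is zero; the Gaussian factor never vanishes. -/
theorem eq_zero_of_orthogonal (hb : 0 < b) {g : L2}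
    (hg : ∀ f : testFn, inner ℂ g (toL2 (landau b f + f)) = 0) : g = 0 := by
  have hG : Continuous fun x : Plane => gaussMonomial b 0 0 x :=
    (contDiff_gaussMonomial 0 0).continuous
  have hF := ae_eq_zero_of_moments (F := fun x => conj (g x) * gaussMonomial b 0 0 x)
    ((Lp.memLp g).star.1.mul hG.aestronglyMeasurable) (fun c => ?_) (fun k l => ?_)
  · refine Lp.ext ?_
    filter_upwards [hF, Lp.coeFn_zero ℂ 2 (volume : Measure Plane)] with x hx h0
    rw [h0]
    have hne : gaussMonomial b 0 0 x ≠ 0 := by simp [gaussMonomial]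
    exact (map_eq_zero _).1 ((mul_eq_zero.1 hx).resolve_right hne)
  · have h := (Lp.memLp g).norm.integrable_mul
      (memLp_exp_norm_sub_sq (β := b / 4) (by positivity) c)
    refine h.congr (Eventually.of_forall fun x => ?_)
    change ‖g x‖ * Real.exp (c * ‖x‖ - b / 4 * ‖x‖ ^ 2) =
      Real.exp (c * ‖x‖) * ‖conj (g x) * gaussMonomial b 0 0 x‖
    rw [norm_mul, RCLike.norm_conj, norm_gaussMonomial, sub_eq_add_neg, Real.exp_add]
    simp
    ring
  · rw [← moment_eq_zero hb hg k l]
    congr 1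
    ext x
    simp only [gaussMonomial]
    ring

/-- Coercivity, `⟨f, (H₀ + 1) f⟩ = ‖a f‖² + (b + 1) ‖f‖²`, combined with the Cauchy–Schwarz
inequality. -/
theorem norm_toL2_le (hb : 0 < b) (f : testFn) : ‖toL2 f‖ ≤ ‖toL2 (landau b f + f)‖ := by
  have h : inner ℂ (toL2 f) (toL2 (landau b f + f)) =
      ((‖toL2 (annihilation b f)‖ ^ 2 + (b + 1) * ‖toL2 f‖ ^ 2 : ℝ) : ℂ) := by
    rw [landau_apply]
    simp only [map_add, map_smul, inner_add_right, inner_smul_right, ← norm_sq_annihilation,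
      inner_self_eq_norm_sq_to_K]
    push_cast
    change _ + (b : ℂ) * (‖toL2 f‖ : ℂ) ^ 2 + (‖toL2 f‖ : ℂ) ^ 2 = _
    ring
  have h1 := norm_inner_le_norm (𝕜 := ℂ) (toL2 f) (toL2 (landau b f + f))
  rw [h, Complex.norm_real, Real.norm_of_nonneg (by positivity)] at h1
  rcases eq_or_lt_of_le (norm_nonneg (toL2 f)) with h0 | h0
  · rw [← h0]
    exact norm_nonneg _
  · have h2 : 0 ≤ b * ‖toL2 f‖ ^ 2 := by positivity
    refine le_of_mul_le_mul_left ?_ h0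
    nlinarith [sq_nonneg ‖toL2 (annihilation b f)‖]

theorem dense_range_landau_add_one (hb : 0 < b) :
    Dense (LinearMap.range (toL2 ∘ₗ (landau b + 1)) : Set L2) := by
  rw [Submodule.dense_iff_topologicalClosure_eq_top, Submodule.topologicalClosure_eq_top_iff,
    Submodule.eq_bot_iff]
  intro g hg
  refine eq_zero_of_orthogonal hb fun f => ?_
  exact Submodule.inner_left_of_mem_orthogonal (LinearMap.mem_range_self _ f) hg

/-- A square integrable distributional eigenvector of the Landau operator is an eigenvector of its
closure from the test functions. -/
theorem mem_graph_H0_of_weak (hb : 0 < b) {w : L2} {c : ℝ}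
    (hw : ∀ f : testFn, inner ℂ w (toL2 (landau b f)) = c * inner ℂ w (toL2 f)) :
    (w, (c : ℂ) • w) ∈ (H0 b).graph := by
  -- Solve `(H₀ + 1) v = (c + 1) w` by approximation: coercivity makes the approximate solutions
  -- converge. Then `w - v` is orthogonal to the range of `H₀ + 1`, which forces `v = w`.
  obtain ⟨s, hs, hlim⟩ := mem_closure_iff_seq_limit.1
    (dense_range_landau_add_one hb (((c : ℂ) + 1) • w))
  choose f hf using hs
  have hlim' : Tendsto (fun n => toL2 (landau b (f n) + f n)) atTop (𝓝 (((c : ℂ) + 1) • w)) :=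
    hlim.congr fun n => (hf n).symm
  have hcau : CauchySeq fun n => toL2 (f n) :=
    cauchySeq_of_sq_le (K := 1) (K₁ := landau b + 1) (K₂ := landau b + 1) (c := 0)
      le_rfl
      (fun g => by
        rw [zero_mul, add_zero]
        exact pow_le_pow_left₀ (norm_nonneg _) (norm_toL2_le hb g) 2) hlim'.cauchySeq hlim'.cauchySeq
  obtain ⟨v, hv⟩ := cauchySeq_tendsto_of_complete hcau
  have hH : Tendsto (fun n => toL2 (landau b (f n))) atTop (𝓝 (((c : ℂ) + 1) • w - v)) := by
    simpa using hlim'.sub hv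
  have hvw : w - v = 0 := by
    refine eq_zero_of_orthogonal hb fun φ => ?_
    have h1 : inner ℂ v (toL2 (landau b φ + φ)) = inner ℂ (((c : ℂ) + 1) • w) (toL2 φ) := by
      refine tendsto_nhds_unique (hv.inner tendsto_const_nhds) ?_
      refine (hlim'.inner tendsto_const_nhds).congr fun n => ?_
      rw [map_add, map_add, inner_add_left, inner_add_right, isFormalAdj_landau]
    rw [inner_sub_left, h1, map_add, inner_add_right, hw, inner_smul_left]
    simp
    ring
  rw [sub_eq_zero] at hvw
  refine mem_graph_H0.2 ⟨f, hvw ▸ hv, ?_⟩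
  convert hH using 2
  rw [← hvw]
  module

/-! ### Landau levels and ladder operators -/

theorem mem_level {q : ℕ} {u : L2} :
    u ∈ level b q ↔ (u, ((b * (2 * q + 1) : ℝ) : ℂ) • u) ∈ (H0 b).graph := by
  rw [level, mem_eigenspace]
  push_cast
  rfl

theorem inner_landau_of_mem_level {q : ℕ} {u : L2} (hu : u ∈ level b q) (f : testFn) :
    inner ℂ u (toL2 (landau b f)) = ((b * (2 * q + 1) : ℝ) : ℂ) * inner ℂ u (toL2 f) := by
  obtain ⟨g, hg, hg'⟩ := mem_graph_H0.1 (mem_level.1 hu)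
  have h1 := Filter.Tendsto.inner (𝕜 := ℂ) hg' (tendsto_const_nhds (x := toL2 f))
  rw [inner_smul_left, Complex.conj_ofReal] at h1
  refine tendsto_nhds_unique (hg.inner tendsto_const_nhds) (h1.congr fun n => ?_)
  exact isFormalAdj_landau b _ _

theorem creation_landau (f : testFn) :
    creation b (landau b f) = landau b (creation b f) - (2 * b : ℂ) • creation b f := by
  rw [landau_apply, landau_apply, annihilation_creation_apply]
  simp only [map_add, map_smul]
  module

theorem annihilation_landau (f : testFn) :
    annihilation b (landau b f) = landau b (annihilation b f) + (2 * b : ℂ) • annihilation b f := by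
  rw [landau_apply, landau_apply, map_add, annihilation_creation_apply]
  simp only [map_smul]
  module

/-- For a test function `f`, `⟨a u, H₀ f⟩ = ⟨u, a* H₀ f⟩` and `a* H₀ = (H₀ - 2b) a*`, so the
eigenvalue is shifted in the weak sense, without knowing that `a u` lies in the domain of `H₀`. -/
theorem Ann.inner_landau {q : ℕ} {u v : L2} (hu : u ∈ level b q) (h : Ann b u v) (f : testFn) :
    inner ℂ v (toL2 (landau b f)) = ((b * (2 * q + 1) - 2 * b : ℝ) : ℂ) * inner ℂ v (toL2 f) := by
  rw [h.inner_eq (cre_toL2 _), h.inner_eq (cre_toL2 _), creation_landau, map_sub, inner_sub_right,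
    inner_landau_of_mem_level hu, map_smul, inner_smul_right]
  push_cast
  ring

theorem Cre.inner_landau {q : ℕ} {u v : L2} (hu : u ∈ level b q) (h : Cre b u v) (f : testFn) :
    inner ℂ v (toL2 (landau b f)) = ((b * (2 * q + 1) + 2 * b : ℝ) : ℂ) * inner ℂ v (toL2 f) := by
  rw [h.inner_eq (ann_toL2 _), h.inner_eq (ann_toL2 _), annihilation_landau, map_add,
    inner_add_right, inner_landau_of_mem_level hu, map_smul, inner_smul_right]
  push_cast
  ring

/-- The weak eigenvector `a* u` is a genuine one by `mem_graph_H0_of_weak`, and `a a* u = (H₀ + b) u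
= 2b(q+1) u`. -/
theorem exists_cre_of_mem_level (hb : 0 < b) {q : ℕ} {u : L2} (hu : u ∈ level b q) :
    ∃ v ∈ level b (q + 1), Cre b u v ∧ Ann b v ((2 * b * (q + 1) : ℂ) • u) := by
  obtain ⟨-, v, -, -, -, -, -, h1, h2, -⟩ := exists_ann_cre_of_mem_graph_H0 hb (mem_level.1 hu)
  refine ⟨v, mem_level.2 ?_, h1, ?_⟩
  · have e : b * (2 * ((q + 1 : ℕ) : ℝ) + 1) = b * (2 * q + 1) + 2 * b := by
      push_cast
      ring
    rw [e]
    exact mem_graph_H0_of_weak hb (h1.inner_landau hu)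
  · convert h2 using 1
    push_cast
    module

theorem exists_ann_of_mem_level_succ (hb : 0 < b) {q : ℕ} {u : L2} (hu : u ∈ level b (q + 1)) :
    ∃ v ∈ level b q, Ann b u v ∧ Cre b v ((2 * b * (q + 1) : ℂ) • u) := by
  obtain ⟨v, -, -, -, h1, h2, -⟩ := exists_ann_cre_of_mem_graph_H0 hb (mem_level.1 hu)
  refine ⟨v, mem_level.2 ?_, h1, ?_⟩
  · have e : b * (2 * (q : ℝ) + 1) = b * (2 * ((q + 1 : ℕ) : ℝ) + 1) - 2 * b := by
      push_cast
      ring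
    rw [e]
    exact mem_graph_H0_of_weak hb (h1.inner_landau hu)
  · convert h2 using 1
    push_cast
    module

/-- On the lowest level `a* a u = (H₀ - b) u = 0`, hence `‖a u‖² = ⟨u, a* a u⟩ = 0`. -/
theorem ann_zero_of_mem_level_zero (hb : 0 < b) {u : L2} (hu : u ∈ level b 0) : Ann b u 0 := by
  obtain ⟨v, -, -, -, h1, h2, -⟩ := exists_ann_cre_of_mem_graph_H0 hb (mem_level.1 hu)
  have hv : inner ℂ v v = (0 : ℂ) := by
    rw [h1.inner_eq h2]
    simp
  rwa [inner_self_eq_zero.1 hv] at h1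

/-- The normalised creation operator maps each Landau level unitarily onto the next one. -/
theorem exists_level_equiv_succ (hb : 0 < b) (q : ℕ) :
    ∃ U : level b q ≃ₗᵢ[ℂ] level b (q + 1), ∀ u : level b q,
      Cre b u ((√(2 * b * (q + 1)) : ℂ) • (U u : L2)) ∧
      Ann b (U u) ((√(2 * b * (q + 1)) : ℂ) • (u : L2)) := by
  set s : ℝ := √(2 * b * (q + 1)) with hs
  have hs0 : 0 < s := Real.sqrt_pos.2 (by positivity)
  have hs0' : (s : ℂ) ≠ 0 := by exact_mod_cast hs0.ne'
  have hss : (s : ℂ) * s = 2 * b * (q + 1) := by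
    rw [← Complex.ofReal_mul, hs, Real.mul_self_sqrt (by positivity)]
    push_cast
    rfl
  choose v hv h1 h2 using fun u : level b q => exists_cre_of_mem_level hb u.2
  let L : level b q →ₗ[ℂ] level b (q + 1) :=
    { toFun := fun u => (s : ℂ)⁻¹ • ⟨v u, hv u⟩
      map_add' := fun x y => by
        have : v (x + y) = v x + v y := (h1 (x + y)).unique ((h1 x).add (h1 y))
        rw [← smul_add]
        congr 1
        exact Subtype.ext this
      map_smul' := fun c x => by
        have : v (c • x) = c • v x := (h1 (c • x)).unique ((h1 x).smul c)
        rw [RingHom.id_apply, smul_comm]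
        congr 1
        exact Subtype.ext this }
  have hL : ∀ u, (L u : L2) = (s : ℂ)⁻¹ • v u := fun u => rfl
  have hnorm : ∀ u, ‖L u‖ = ‖u‖ := by
    intro u
    have h : inner ℂ (v u) (v u) = (s * s : ℂ) * inner ℂ (u : L2) (u : L2) := by
      rw [(h1 u).inner_eq (h2 u), inner_smul_right, hss]
    rw [inner_self_eq_norm_sq_to_K, inner_self_eq_norm_sq_to_K] at h
    have h' : ‖v u‖ ^ 2 = (s * ‖(u : L2)‖) ^ 2 := by
      apply Complex.ofReal_injective
      push_cast
      rw [mul_pow, pow_two (s : ℂ)]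
      exact h
    have h'' := (sq_eq_sq₀ (norm_nonneg _) (by positivity)).1 h'
    change ‖(L u : L2)‖ = ‖(u : L2)‖
    rw [hL, norm_smul, norm_inv, Complex.norm_real, Real.norm_of_nonneg hs0.le, h'',
      inv_mul_cancel_left₀ hs0.ne']
  -- The preimage of `w` is `s⁻¹ a w`, because `a* a w = s² w` on the level `q + 1`.
  have hsurj : Function.Surjective (⟨L, hnorm⟩ : level b q →ₗᵢ[ℂ] level b (q + 1)) := by
    intro w
    obtain ⟨t, ht, ha, hc⟩ := exists_ann_of_mem_level_succ hb w.2
    refine ⟨(s : ℂ)⁻¹ • ⟨t, ht⟩, Subtype.ext ?_⟩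
    change (L ((s : ℂ)⁻¹ • ⟨t, ht⟩) : L2) = w
    rw [map_smul, Submodule.coe_smul, hL, (h1 ⟨t, ht⟩).unique hc, ← hss, smul_smul, smul_smul]
    rw [show (s : ℂ)⁻¹ * (s : ℂ)⁻¹ * (s * s) = 1 by field_simp, one_smul]
  refine ⟨LinearIsometryEquiv.ofSurjective ⟨L, hnorm⟩ hsurj, fun u => ?_⟩
  change Cre b u ((s : ℂ) • (L u : L2)) ∧ Ann b (L u) ((s : ℂ) • (u : L2))
  rw [hL, smul_inv_smul₀ hs0']
  refine ⟨h1 u, ?_⟩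
  convert (h2 u).smul (s : ℂ)⁻¹ using 1
  rw [← hss, smul_smul, inv_mul_cancel_left₀ hs0']

/-- The unitary operators from the lowest Landau level onto the other ones, given by the normalised
powers of the creation operator. -/
theorem exists_level_equiv (hb : 0 < b) :
    ∃ e : ∀ q, level b 0 ≃ₗᵢ[ℂ] level b q, (∀ u, e 0 u = u) ∧ ∀ q u,
      Cre b (e q u) ((√(2 * b * (q + 1)) : ℂ) • (e (q + 1) u : L2)) ∧
      Ann b (e (q + 1) u) ((√(2 * b * (q + 1)) : ℂ) • (e q u : L2)) := by
  choose U hU using fun q => exists_level_equiv_succ hb q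
  exact ⟨fun q => Nat.rec (motive := fun q => level b 0 ≃ₗᵢ[ℂ] level b q)
    (LinearIsometryEquiv.refl ℂ _) (fun q e => e.trans (U q)) q, fun u => rfl, fun q u => hU q _⟩

/-- The norm of the `q`-th power of the creation operator on the lowest Landau level. -/
def ladderNorm (b : ℝ) (q : ℕ) : ℝ := √((2 * b) ^ q * q.factorial)

theorem ladderNorm_sq (hb : 0 < b) (q : ℕ) :
    (ladderNorm b q : ℂ) * ladderNorm b q = (2 * b) ^ q * q.factorial := by
  rw [← Complex.ofReal_mul, ladderNorm, Real.mul_self_sqrt (by positivity)]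
  push_cast
  rfl

theorem ladderNorm_pos (hb : 0 < b) (q : ℕ) : 0 < ladderNorm b q :=
  Real.sqrt_pos.2 (by positivity)

theorem ladderNorm_succ (hb : 0 < b) (q : ℕ) :
    ladderNorm b (q + 1) = √(2 * b * (q + 1)) * ladderNorm b q := by
  rw [ladderNorm, ladderNorm, ← Real.sqrt_mul (by positivity)]
  congr 1
  rw [Nat.factorial_succ]
  push_cast
  ring

/-- The unitaries `e q` from the lowest Landau level onto the `q`-th one are such that
`ladderNorm b q • e q` is the `q`-th power of the creation operator. -/
theorem exists_level_equiv_pow (hb : 0 < b) :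
    ∃ e : ∀ q, level b 0 ≃ₗᵢ[ℂ] level b q,
      (∀ u, (ladderNorm b 0 : ℂ) • (e 0 u : L2) = u) ∧
      (∀ u, Ann b ((ladderNorm b 0 : ℂ) • (e 0 u : L2)) 0) ∧ ∀ q u,
      Cre b ((ladderNorm b q : ℂ) • (e q u : L2)) ((ladderNorm b (q + 1) : ℂ) • (e (q + 1) u : L2)) ∧
      Ann b ((ladderNorm b (q + 1) : ℂ) • (e (q + 1) u : L2))
        ((2 * b * (q + 1) : ℂ) • (ladderNorm b q : ℂ) • (e q u : L2)) := by
  obtain ⟨e, h0, h⟩ := exists_level_equiv hb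
  have hn : ladderNorm b 0 = 1 := by simp [ladderNorm]
  refine ⟨e, fun u => ?_, fun u => ?_, fun q u => ⟨?_, ?_⟩⟩
  · rw [hn, Complex.ofReal_one, one_smul, h0]
  · rw [hn, Complex.ofReal_one, one_smul]
    exact ann_zero_of_mem_level_zero hb (e 0 u).2
  · convert (h q u).1.smul (ladderNorm b q : ℂ) using 1
    rw [ladderNorm_succ hb, smul_smul]
    push_cast
    ring_nf
  · convert (h q u).2.smul (ladderNorm b (q + 1) : ℂ) using 1
    have hss : ((√(2 * b * (q + 1)) : ℝ) : ℂ) * (√(2 * b * (q + 1)) : ℝ) = 2 * b * (q + 1) := by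
      rw [← Complex.ofReal_mul, Real.mul_self_sqrt (by positivity)]
      push_cast
      rfl
    rw [ladderNorm_succ hb, smul_smul, smul_smul, ← hss]
    push_cast
    ring_nf

/-! ### The algebra of `C_b^∞` functions -/

theorem IsCbInfty.add {f g : Plane → ℂ} (hf : IsCbInfty f) (hg : IsCbInfty g) :
    IsCbInfty (f + g) := by
  refine ⟨hf.1.add hg.1, fun n => ?_⟩
  obtain ⟨C, hC⟩ := hf.2 n
  obtain ⟨D, hD⟩ := hg.2 n
  refine ⟨C + D, fun x => ?_⟩
  rw [iteratedFDeriv_add_apply ((hf.1.of_le (by exact_mod_cast le_top)).contDiffAt)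
    ((hg.1.of_le (by exact_mod_cast le_top)).contDiffAt)]
  exact (norm_add_le _ _).trans (add_le_add (hC x) (hD x))

theorem IsCbInfty.clm_comp {f : Plane → ℂ} (hf : IsCbInfty f) (L : ℂ →L[ℝ] ℂ) :
    IsCbInfty (L ∘ f) := by
  refine ⟨L.contDiff.comp hf.1, fun n => ?_⟩
  obtain ⟨C, hC⟩ := hf.2 n
  exact ⟨‖L‖ * C, fun x => (L.norm_iteratedFDeriv_comp_left (N := ∞) hf.1.contDiffAt
    (by exact_mod_cast le_top)).trans (mul_le_mul_of_nonneg_left (hC x) (norm_nonneg L))⟩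

theorem IsCbInfty.const_smul {f : Plane → ℂ} (hf : IsCbInfty f) (c : ℂ) : IsCbInfty (c • f) :=
  hf.clm_comp ((ContinuousLinearMap.mul ℝ ℂ) c)

theorem IsCbInfty.conj {f : Plane → ℂ} (hf : IsCbInfty f) : IsCbInfty fun x => conj (f x) :=
  hf.clm_comp Complex.conjCLE.toContinuousLinearMap

theorem IsCbInfty.pderiv {f : Plane → ℂ} (hf : IsCbInfty f) (j : Fin 2) :
    IsCbInfty (pderiv j f) := by
  refine ⟨contDiff_pderiv hf.1 j, fun n => ?_⟩
  obtain ⟨C, hC⟩ := hf.2 (n + 1)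
  let L : (Plane →L[ℝ] ℂ) →L[ℝ] ℂ :=
    ContinuousLinearMap.apply ℝ ℂ (EuclideanSpace.single j (1 : ℝ) : Plane)
  refine ⟨‖L‖ * C, fun x => ?_⟩
  refine (L.norm_iteratedFDeriv_comp_left (N := ∞) (f := fderiv ℝ f)
    (hf.1.fderiv_right (m := ∞) (by simp)).contDiffAt (by exact_mod_cast le_top)).trans ?_
  rw [norm_iteratedFDeriv_fderiv]
  exact mul_le_mul_of_nonneg_left (hC x) (norm_nonneg L)

theorem isCbInfty_zero : IsCbInfty 0 :=
  ⟨contDiff_const, fun n => ⟨0, fun x => by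
    rw [show (0 : Plane → ℂ) = fun _ => 0 from rfl, iteratedFDeriv_fun_zero]
    simp⟩⟩

/-- The space `C_b^∞(ℝ²)`. -/
def cbFn : Submodule ℂ (Plane → ℂ) where
  carrier := {f | IsCbInfty f}
  add_mem' hf hg := hf.add hg
  zero_mem' := isCbInfty_zero
  smul_mem' c _ hf := hf.const_smul c

/-- `∂/∂x_j` on `C_b^∞`. -/
def cbPderiv (j : Fin 2) : Module.End ℂ cbFn where
  toFun f := ⟨pderiv j f.1, f.2.pderiv j⟩
  map_add' f g := by
    ext x
    have hf := (f.2.1.differentiable (by simp)) x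
    have hg := (g.2.1.differentiable (by simp)) x
    simp [pderiv, fderiv_add hf hg]
  map_smul' c f := by
    ext x
    have hf := (f.2.1.differentiable (by simp)) x
    simp [pderiv, fderiv_const_smul hf c]

theorem cbPderiv_comm (j k : Fin 2) (f : cbFn) :
    cbPderiv j (cbPderiv k f) = cbPderiv k (cbPderiv j f) :=
  Subtype.ext (pderiv_comm f.2.1 j k)

/-- The commutator with the annihilation operator, `-2i ∂/∂z̄`, on `C_b^∞`. -/
def cbAnn : Module.End ℂ cbFn := (-Complex.I) • (cbPderiv 0 + Complex.I • cbPderiv 1)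

/-- Minus the commutator with the creation operator, `2i ∂/∂z`, on `C_b^∞`. -/
def cbNegCre : Module.End ℂ cbFn := Complex.I • (cbPderiv 0 - Complex.I • cbPderiv 1)

/-- The Laplacian on `C_b^∞`. -/
def cbLaplacian : Module.End ℂ cbFn := cbPderiv 0 * cbPderiv 0 + cbPderiv 1 * cbPderiv 1

theorem cbAnn_apply (w : cbFn) (x : Plane) : (cbAnn w).1 x = -2 * Complex.I * dzbar w.1 x := by
  change -Complex.I * (pderiv 0 w.1 x + Complex.I * pderiv 1 w.1 x) = _
  rw [dzbar]
  ring

theorem cbNegCre_apply (w : cbFn) (x : Plane) : (cbNegCre w).1 x = 2 * Complex.I * dz w.1 x := by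
  change Complex.I * (pderiv 0 w.1 x - Complex.I * pderiv 1 w.1 x) = _
  rw [dz]
  ring

/-- This is `4 ∂²/∂z∂z̄ = Δ`; the signs of the two operators are chosen so that their product is
exactly the Laplacian. -/
theorem cbAnn_cbNegCre (w : cbFn) : cbAnn (cbNegCre w) = cbLaplacian w := by
  simp only [cbAnn, cbNegCre, cbLaplacian, LinearMap.smul_apply, LinearMap.add_apply,
    LinearMap.sub_apply, Module.End.mul_apply, map_smul, map_sub, cbPderiv_comm 1 0, smul_add,
    smul_sub, smul_smul]
  match_scalars <;> first
    | ring1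
    | linear_combination -Complex.I_sq
    | linear_combination (Complex.I ^ 2 - 1) * Complex.I_sq

theorem cbNegCre_cbAnn (w : cbFn) : cbNegCre (cbAnn w) = cbLaplacian w := by
  simp only [cbAnn, cbNegCre, cbLaplacian, LinearMap.smul_apply, LinearMap.add_apply,
    LinearMap.sub_apply, Module.End.mul_apply, map_smul, map_add, cbPderiv_comm 1 0, smul_add,
    smul_sub, smul_smul]
  match_scalars <;> first
    | ring1
    | linear_combination -Complex.I_sq
    | linear_combination (Complex.I ^ 2 - 1) * Complex.I_sq

theorem laplacian_eq_pderiv {f : Plane → ℂ} (hf : ContDiff ℝ ∞ f) :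
    Laplacian.laplacian f = pderiv 0 (pderiv 0 f) + pderiv 1 (pderiv 1 f) := by
  have hd : Differentiable ℝ (fderiv ℝ f) :=
    (hf.fderiv_right (m := ∞) (by simp)).differentiable (by simp)
  rw [InnerProductSpace.laplacian_eq_iteratedFDeriv_orthonormalBasis f
    (EuclideanSpace.basisFun (Fin 2) ℝ)]
  have key : ∀ (j : Fin 2) (x : Plane), pderiv j (pderiv j f) x =
      iteratedFDeriv ℝ 2 f x ![EuclideanSpace.single j 1, EuclideanSpace.single j 1] := by
    intro j x
    unfold pderiv
    rw [fderiv_clm_apply (hd x) (differentiableAt_const _), iteratedFDeriv_two_apply]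
    simp
  ext x
  rw [Fin.sum_univ_two, Pi.add_apply, key, key]
  simp

theorem cbLaplacian_pow_coe (j : ℕ) (w : cbFn) :
    ((cbLaplacian ^ j) w).1 = Laplacian.laplacian^[j] w.1 := by
  induction j with
  | zero => rfl
  | succ j ih =>
    rw [pow_succ', Module.End.mul_apply, Function.iterate_succ_apply', ← ih,
      laplacian_eq_pderiv ((cbLaplacian ^ j) w).2.1]
    rfl

/-- The operator `L_s^{(m)}(-Δ/(2b))` on `C_b^∞`. -/
def cbLaguerre (b : ℝ) (s m : ℕ) : Module.End ℂ cbFn :=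
  ∑ j ∈ Finset.range (s + 1),
    ((s + m).choose (s - j) / (j.factorial * (2 * b) ^ j) : ℂ) • cbLaplacian ^ j

theorem cbLaguerre_coe (b : ℝ) (s m : ℕ) (w : cbFn) (x : Plane) :
    (cbLaguerre b s m w).1 x = polyLaplacian b (laguerre s m) w.1 x := by
  have hdeg : (laguerre s m).natDegree < s + 1 := by
    refine Nat.lt_succ_of_le (natDegree_sum_le_of_forall_le _ _ fun j hj => ?_)
    exact (natDegree_C_mul_X_pow_le _ _).trans (Nat.lt_succ_iff.1 (Finset.mem_range.1 hj))
  rw [polyLaplacian, Polynomial.sum_over_range' _ (by simp) (s + 1) hdeg]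
  have hl : (cbLaguerre b s m w).1 x = ∑ j ∈ Finset.range (s + 1),
      ((s + m).choose (s - j) / (j.factorial * (2 * b) ^ j) : ℂ) * ((cbLaplacian ^ j) w).1 x := by
    rw [cbLaguerre, LinearMap.sum_apply, Submodule.coe_sum, Finset.sum_apply]
    rfl
  rw [hl]
  refine Finset.sum_congr rfl fun j hj => ?_
  have hc : (laguerre s m).coeff j = ((s + m).choose (s - j) : ℝ) * (-1) ^ j / j.factorial := by
    rw [laguerre, finsetSum_coeff]
    simp only [coeff_C_mul_X_pow]
    rw [Finset.sum_ite_eq, if_pos hj]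
  rw [cbLaplacian_pow_coe, hc]
  push_cast
  -- The sign `(-1)^j` of the Laguerre coefficient cancels that of `(-Δ/(2b))^j`.
  have h1 : (-1 : ℂ) ^ j * (-1 / (2 * b)) ^ j = 1 / (2 * b) ^ j := by
    rw [← mul_pow, div_eq_mul_inv, ← mul_assoc, neg_one_mul, neg_neg, one_mul, one_div, inv_pow]
  linear_combination (-((s + m).choose (s - j) : ℂ) / j.factorial *
    (Laplacian.laplacian^[j] w.1 x)) * h1

/-! ### A recurrence of Laguerre type -/

/-- Here `J m n w` models `⟨F' m, w F n⟩`. Of the `m` annihilation operators moved to the right,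
`p.1` differentiate `w` through `D` and `p.2` lower the right vector, at the cost `c^{p.2} n(n-1)⋯`;
the `n - p.2` remaining creation operators move left and act on `w` through `E`. For `p.2 > n` the
descending factorial vanishes, so the truncated exponent is immaterial. -/
theorem sum_of_commutator_recurrence {M : Type*} [AddCommGroup M] [Module ℂ M]
    {D E : Module.End ℂ M} (hDE : Commute D E) {J : ℕ → ℕ → M → ℂ} {c : ℂ}
    (h0 : ∀ n w, J 0 (n + 1) w = J 0 n (E w)) (h1 : ∀ m w, J (m + 1) 0 w = J m 0 (D w))
    (h2 : ∀ m n w, J (m + 1) (n + 1) w = J m (n + 1) (D w) + c * (n + 1) * J m n w) (m n : ℕ) (w : M) :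
    J m n w = ∑ p ∈ Finset.HasAntidiagonal.antidiagonal m, (m.choose p.1 : ℂ) *
      (n.descFactorial p.2 * c ^ p.2 * J 0 0 ((D ^ p.1) ((E ^ (n - p.2)) w))) := by
  induction m generalizing n w with
  | zero =>
    simp only [Finset.HasAntidiagonal.antidiagonal_zero, Finset.sum_singleton, Nat.choose_self, Nat.cast_one,
      Nat.descFactorial_zero, pow_zero, mul_one, one_mul, Nat.sub_zero, Module.End.one_apply]
    induction n generalizing w with
    | zero => rfl
    | succ n ih => rw [h0, ih, pow_succ, Module.End.mul_apply]
  | succ m ih =>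
    -- Pascal's rule separates the cases where the additional annihilation operator lowers the right
    -- vector or differentiates `w`.
    rw [Finset.sum_antidiagonal_choose_succ_mul
      (fun i k => n.descFactorial k * c ^ k * J 0 0 ((D ^ i) ((E ^ (n - k)) w)))]
    have e2 : ∑ p ∈ Finset.HasAntidiagonal.antidiagonal m, (m.choose p.2 : ℂ) *
        (n.descFactorial p.2 * c ^ p.2 * J 0 0 ((D ^ (p.1 + 1)) ((E ^ (n - p.2)) w))) =
        J m n (D w) := by
      rw [ih]
      refine Finset.sum_congr rfl fun p hp => ?_
      rw [Nat.choose_symm_of_eq_add (Finset.HasAntidiagonal.mem_antidiagonal.1 hp).symm, pow_succ,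
        Module.End.mul_apply, ← Module.End.mul_apply D, (hDE.pow_right _).eq, Module.End.mul_apply]
    rw [e2]
    rcases n with _ | n
    · simp [h1]
    · rw [h2, ih n, Finset.mul_sum, add_comm]
      congr 1
      refine Finset.sum_congr rfl fun p _ => ?_
      rw [Nat.succ_descFactorial_succ, Nat.succ_sub_succ]
      push_cast
      ring

/-- In the expansion of `J (s + m) s`, only terms with at most `s` lowerings survive. Writing their
number as `s - j` leaves `D^{m+j} E^j = (DE)^j D^m`, and `s!/j!` times the binomial coefficient
gives the Laguerre coefficient. -/
theorem laguerre_sum_of_commutator_recurrence {M : Type*} [AddCommGroup M] [Module ℂ M]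
    {D E : Module.End ℂ M} (hDE : Commute D E) {J : ℕ → ℕ → M → ℂ} {c : ℂ}
    (h0 : ∀ n w, J 0 (n + 1) w = J 0 n (E w)) (h1 : ∀ m w, J (m + 1) 0 w = J m 0 (D w))
    (h2 : ∀ m n w, J (m + 1) (n + 1) w = J m (n + 1) (D w) + c * (n + 1) * J m n w)
    (hc : c ≠ 0) (s m : ℕ) (w : M) :
    J (s + m) s w = c ^ s * s.factorial * ∑ j ∈ Finset.range (s + 1),
      ((s + m).choose (s - j) / (j.factorial * c ^ j) : ℂ) *
        J 0 0 (((D * E) ^ j) ((D ^ m) w)) := by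
  rw [sum_of_commutator_recurrence hDE h0 h1 h2, Finset.Nat.sum_antidiagonal_eq_sum_range_succ_mk,
    show (s + m).succ = m + (s + 1) by omega, Finset.sum_range_add, Finset.sum_eq_zero, zero_add,
    Finset.mul_sum]
  · refine Finset.sum_congr rfl fun j hj => ?_
    have hj' : j ≤ s := Nat.lt_succ_iff.1 (Finset.mem_range.1 hj)
    have hsub : s + m - (m + j) = s - j := by omega
    have hch : (s + m).choose (m + j) = (s + m).choose (s - j) :=
      Nat.choose_symm_of_eq_add (by omega)
    have hf : ((j.factorial : ℂ)) * s.descFactorial (s - j) = s.factorial := by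
      have := Nat.factorial_mul_descFactorial (n := s) (k := s - j) (by omega)
      rw [Nat.sub_sub_self hj'] at this
      exact_mod_cast this
    have hpow : c ^ s = c ^ (s - j) * c ^ j := by rw [← pow_add, Nat.sub_add_cancel hj']
    have hop : (D ^ (m + j)) ((E ^ j) w) = ((D * E) ^ j) ((D ^ m) w) := by
      have : D ^ (m + j) * E ^ j = (D * E) ^ j * D ^ m := by
        rw [hDE.mul_pow, add_comm, pow_add, mul_assoc, mul_assoc, (hDE.pow_pow m j).eq]
      exact LinearMap.congr_fun this w
    dsimp only
    rw [hsub, hch, Nat.sub_sub_self hj', hop, hpow, ← hf]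
    have : (j.factorial : ℂ) ≠ 0 := by exact_mod_cast j.factorial_ne_zero
    field_simp
  -- For `i < m` more than `s` lowerings would be required.
  · intro i hi
    have hi' : s < s + m - i := by
      have := Finset.mem_range.1 hi
      omega
    simp [Nat.descFactorial_of_lt hi']

/-! ### Multiplication operators -/

theorem exists_norm_le (w : cbFn) : ∃ C : ℝ, ∀ x, ‖w.1 x‖ ≤ C := by
  obtain ⟨C, hC⟩ := w.2.2 0
  exact ⟨C, fun x => by simpa using hC x⟩

theorem memLp_cb_mul (w : cbFn) (u : L2) :
    MemLp (fun x => w.1 x * u x) 2 (volume : Measure Plane) := by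
  obtain ⟨C, hC⟩ := exists_norm_le w
  refine MemLp.of_le_mul (c := C) (Lp.memLp u)
    (w.2.1.continuous.aestronglyMeasurable.mul (Lp.aestronglyMeasurable u))
    (Eventually.of_forall fun x => ?_)
  rw [norm_mul]
  exact mul_le_mul_of_nonneg_right (hC x) (norm_nonneg _)

/-- Multiplication by a `C_b^∞` function, as a bounded operator. -/
def mulL2 (w : cbFn) : L2 →L[ℂ] L2 :=
  LinearMap.mkContinuousOfExistsBound
    { toFun := fun u => (memLp_cb_mul w u).toLp fun x => w.1 x * u x
      map_add' := fun u v => (MemLp.toLp_congr _ ((memLp_cb_mul w u).add (memLp_cb_mul w v))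
        (ae_mul_add w.1 u v)).trans (MemLp.toLp_add (memLp_cb_mul w u) (memLp_cb_mul w v))
      map_smul' := fun c u => (MemLp.toLp_congr _ ((memLp_cb_mul w u).const_smul c)
        (ae_mul_smul w.1 c u)).trans (MemLp.toLp_const_smul c (memLp_cb_mul w u)) }
    (by
      obtain ⟨C, hC⟩ := exists_norm_le w
      refine ⟨C, fun u => Lp.norm_le_mul_norm_of_ae_le_mul ?_⟩
      filter_upwards [MemLp.coeFn_toLp (memLp_cb_mul w u)] with x hx
      change ‖(memLp_cb_mul w u).toLp (fun x => w.1 x * u x) x‖ ≤ _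
      rw [hx, norm_mul]
      exact mul_le_mul_of_nonneg_right (hC x) (norm_nonneg _))

theorem coeFn_mulL2 (w : cbFn) (u : L2) : mulL2 w u =ᵐ[volume] fun x => w.1 x * u x :=
  MemLp.coeFn_toLp (memLp_cb_mul w u)

theorem mulL2_add (w w' : cbFn) (u : L2) : mulL2 (w + w') u = mulL2 w u + mulL2 w' u := by
  refine Lp.ext ?_
  filter_upwards [coeFn_mulL2 (w + w') u, coeFn_mulL2 w u, coeFn_mulL2 w' u,
    Lp.coeFn_add (mulL2 w u) (mulL2 w' u)] with x h1 h2 h3 h4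
  rw [h1, h4, Pi.add_apply, h2, h3]
  exact add_mul _ _ _

theorem mulL2_smul (c : ℂ) (w : cbFn) (u : L2) : mulL2 (c • w) u = c • mulL2 w u := by
  refine Lp.ext ?_
  filter_upwards [coeFn_mulL2 (c • w) u, coeFn_mulL2 w u, Lp.coeFn_smul c (mulL2 w u)]
    with x h1 h2 h3
  rw [h1, h3, Pi.smul_apply, h2]
  exact mul_assoc _ _ _

/-- The multiplication operators depend linearly on the multiplier. -/
def mulL2Form (u v : L2) : cbFn →ₗ[ℂ] ℂ where
  toFun w := inner ℂ u (mulL2 w v)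
  map_add' w w' := by rw [mulL2_add, inner_add_right]
  map_smul' c w := by rw [mulL2_smul, inner_smul_right, RingHom.id_apply, smul_eq_mul]

theorem inner_mulL2_conj {w w' : cbFn} (h : ∀ x, w'.1 x = conj (w.1 x)) (u v : L2) :
    inner ℂ u (mulL2 w' v) = conj (inner ℂ v (mulL2 w u)) := by
  rw [inner_conj_symm, L2.inner_def, L2.inner_def]
  refine integral_congr_ae ?_
  filter_upwards [coeFn_mulL2 w' v, coeFn_mulL2 w u] with x h1 h2
  rw [h1, h2, h]
  simp only [RCLike.inner_apply, map_mul]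
  ring

theorem mulL2_toL2 (w : cbFn) (f : testFn) : mulL2 w (toL2 f) = toL2 (mulTest w.1 w.2.1 f) := by
  refine Lp.ext ?_
  filter_upwards [coeFn_mulL2 w (toL2 f), MemLp.coeFn_toLp (memLp_testFn f),
    MemLp.coeFn_toLp (memLp_testFn (mulTest w.1 w.2.1 f))] with x h1 h2 h3
  rw [h1]
  refine Eq.trans ?_ h3.symm
  exact congrArg (w.1 x * ·) h2

/-- The Leibniz rule survives the closure because both `w` and its commutator with `a` are bounded
multipliers. -/
theorem Ann.mul {u v : L2} (h : Ann b u v) (w : cbFn) :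
    Ann b (mulL2 w u) (mulL2 w v + mulL2 (cbAnn w) u) := by
  obtain ⟨f, hf, hf'⟩ := ann_iff.1 h
  refine ann_iff.2 ⟨fun n => mulTest w.1 w.2.1 (f n), ?_, ?_⟩
  · simp_rw [← mulL2_toL2]
    exact ((mulL2 w).continuous.tendsto u).comp hf
  · have : ∀ n, toL2 (annihilation b (mulTest w.1 w.2.1 (f n))) =
        mulL2 w (toL2 (annihilation b (f n))) + mulL2 (cbAnn w) (toL2 (f n)) := by
      intro n
      rw [annihilation_mulTest, map_add, mulL2_toL2, mulL2_toL2]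
      congr 2
      ext x
      change (-2 * Complex.I) * (dzbar w.1 x * (f n).1 x) = (cbAnn w).1 x * (f n).1 x
      rw [cbAnn_apply]
      ring
    simp_rw [this]
    exact (((mulL2 w).continuous.tendsto v).comp hf').add
      (((mulL2 (cbAnn w)).continuous.tendsto u).comp hf)

theorem Cre.mul {u v : L2} (h : Cre b u v) (w : cbFn) :
    Cre b (mulL2 w u) (mulL2 w v - mulL2 (cbNegCre w) u) := by
  obtain ⟨f, hf, hf'⟩ := cre_iff.1 h
  refine cre_iff.2 ⟨fun n => mulTest w.1 w.2.1 (f n), ?_, ?_⟩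
  · simp_rw [← mulL2_toL2]
    exact ((mulL2 w).continuous.tendsto u).comp hf
  · have : ∀ n, toL2 (creation b (mulTest w.1 w.2.1 (f n))) =
        mulL2 w (toL2 (creation b (f n))) - mulL2 (cbNegCre w) (toL2 (f n)) := by
      intro n
      rw [creation_mulTest, mulL2_toL2, mulL2_toL2, ← map_sub]
      congr 1
      ext x
      change w.1 x * (creation b (f n)).1 x + (-2 * Complex.I) * (dz w.1 x * (f n).1 x) =
        w.1 x * (creation b (f n)).1 x - (cbNegCre w).1 x * (f n).1 x
      rw [cbNegCre_apply]
      ring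
    simp_rw [this]
    exact (((mulL2 w).continuous.tendsto v).comp hf').sub
      (((mulL2 (cbNegCre w)).continuous.tendsto u).comp hf)

/-- Matrix elements of a multiplication operator between the vectors of two ladders. -/
theorem inner_ladder_mulL2 (hb : 0 < b) {F F' : ℕ → L2} (hF0 : Ann b (F 0) 0) (hF0' : Ann b (F' 0) 0)
    (hFc : ∀ n, Cre b (F n) (F (n + 1))) (hFc' : ∀ n, Cre b (F' n) (F' (n + 1)))
    (hFa : ∀ n : ℕ, Ann b (F (n + 1)) ((2 * b * (n + 1) : ℂ) • F n)) (s m : ℕ) (w : cbFn) :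
    inner ℂ (F' (s + m)) (mulL2 w (F s)) = (2 * b) ^ s * s.factorial *
      inner ℂ (F' 0) (mulL2 (cbLaguerre b s m ((cbAnn ^ m) w)) (F 0)) := by
  have hcomm : Commute cbAnn cbNegCre := LinearMap.ext fun w =>
    (cbAnn_cbNegCre w).trans (cbNegCre_cbAnn w).symm
  have hDE : cbAnn * cbNegCre = cbLaplacian := LinearMap.ext cbAnn_cbNegCre
  have hc : (2 * b : ℂ) ≠ 0 := by
    have : (2 * b : ℝ) ≠ 0 := by positivity
    exact_mod_cast this
  have key := laguerre_sum_of_commutator_recurrence (D := cbAnn) (E := cbNegCre) hcomm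
    (J := fun m n w => inner ℂ (F' m) (mulL2 w (F n))) (c := 2 * b) ?_ ?_ ?_ hc s m w
  · rw [hDE] at key
    refine key.trans ?_
    congr 1
    change _ = mulL2Form (F' 0) (F 0) (cbLaguerre b s m ((cbAnn ^ m) w))
    rw [cbLaguerre, LinearMap.sum_apply, map_sum]
    refine Finset.sum_congr rfl fun j _ => ?_
    rw [LinearMap.smul_apply, map_smul]
    rfl
  -- A creation operator moved from the right vector onto `F' 0` becomes `a`, which kills it; only
  -- the commutator with `w` remains.
  · intro n w
    have h := hF0'.inner_eq ((hFc n).mul w)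
    rw [inner_zero_left, inner_sub_right] at h
    exact sub_eq_zero.1 h.symm
  · intro m w
    have h := (hFc' m).inner_eq (hF0.mul w)
    rwa [map_zero, zero_add] at h
  · intro m n w
    have h := (hFc' m).inner_eq ((hFa n).mul w)
    rw [inner_add_right, map_smul, inner_smul_right] at h
    rw [h]
    ring

/-! ### Graphs of compositions -/

section Abstract

variable {E F G : Type*} [NormedAddCommGroup E] [InnerProductSpace ℂ E]
  [NormedAddCommGroup F] [InnerProductSpace ℂ F] [NormedAddCommGroup G] [InnerProductSpace ℂ G]

theorem mem_graph_pcomp {g : F →ₗ.[ℂ] G} {f : E →ₗ.[ℂ] F} {x : E} {y : F} {z : G}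
    (h : (x, y) ∈ f.graph) (h' : (y, z) ∈ g.graph) : (x, z) ∈ (pcomp g f).graph := by
  obtain ⟨⟨x, hx⟩, rfl, rfl⟩ := (LinearPMap.mem_graph_iff _).1 h
  obtain ⟨⟨y, hy⟩, h1, rfl⟩ := (LinearPMap.mem_graph_iff _).1 h'
  dsimp only at h1
  subst h1
  exact (LinearPMap.mem_graph_iff _).2 ⟨⟨x, hx, hy⟩, rfl, rfl⟩

theorem mem_graph_everywhere (f : E →ₗ[ℂ] F) (x : E) : (x, f x) ∈ (everywhere f).graph :=
  (LinearPMap.mem_graph_iff _).2 ⟨⟨x, trivial⟩, rfl, rfl⟩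

theorem domain_eq_top_of_forall {T : E →ₗ.[ℂ] F} (h : ∀ x, ∃ y, (x, y) ∈ T.graph) :
    T.domain = ⊤ :=
  eq_top_iff.2 fun x _ => LinearPMap.mem_domain_iff.2 (h x)

/-- Since graphs are single-valued and `T` is everywhere defined, carrying one point of the graph
over each `x` already gives both implications. -/
theorem unitarilyEquivalent_of_forall {T : E →ₗ.[ℂ] E} {S : F →ₗ.[ℂ] F} (W : E ≃ₗᵢ[ℂ] F)
    (h : ∀ x, ∃ y, (x, y) ∈ T.graph ∧ (W x, W y) ∈ S.graph) : UnitarilyEquivalent T S := by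
  refine ⟨W, fun x y => ?_⟩
  obtain ⟨z, hT, hS⟩ := h x
  constructor
  · intro hy
    obtain rfl : y = z := LinearPMap.mem_graph_snd_inj' _ hy hT rfl
    exact hS
  · intro hy
    obtain rfl : y = z := W.injective (LinearPMap.mem_graph_snd_inj' _ hy hS rfl)
    exact hT

end Abstract

theorem mem_graph_compression {q : ℕ} {T : L2 →ₗ.[ℂ] L2} {x : level b q} {y : L2}
    (h : ((x : L2), y) ∈ T.graph) : (x, levelProj b q y) ∈ (compression b q T).graph :=
  mem_graph_pcomp (mem_graph_pcomp (mem_graph_everywhere (level b q).subtype x) h)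
    (mem_graph_everywhere (levelProj b q) y)

theorem inner_levelProj {q : ℕ} (x : level b q) (y : L2) :
    inner ℂ x (levelProj b q y) = inner ℂ (x : L2) y :=
  Submodule.inner_orthogonalProjectionOnto_eq_of_mem_left x y

theorem mem_graph_mulOp (w : cbFn) (u : L2) : (u, mulL2 w u) ∈ (mulOp w.1).graph :=
  (LinearPMap.mem_graph_iff _).2 ⟨⟨u, memLp_cb_mul w u⟩, rfl, rfl⟩

/-! ### The operator `𝔸* Ω 𝔸` -/

theorem mem_graph_bigA {u p r : L2} (hp : Cre b u p) (hr : Ann b u r) :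
    (u, WithLp.toLp 2 ![p, r]) ∈ (bigA b).graph := by
  obtain ⟨⟨u', hu'⟩, rfl, rfl⟩ := (LinearPMap.mem_graph_iff _).1 hp
  obtain ⟨⟨v, hv⟩, h1, rfl⟩ := (LinearPMap.mem_graph_iff _).1 hr
  dsimp only at h1
  subst h1
  exact (LinearPMap.mem_graph_iff _).2 ⟨⟨v, hu', hv⟩, rfl, rfl⟩

theorem mem_graph_matMulOp {Ω : Plane → Matrix (Fin 2) (Fin 2) ℂ} (w : Fin 2 → Fin 2 → cbFn)
    (hw : ∀ j k x, (w j k).1 x = Ω x j k) (p r : L2) :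
    ((WithLp.toLp 2 ![p, r] : L2x2), (WithLp.toLp 2 ![mulL2 (w 0 0) p + mulL2 (w 0 1) r,
      mulL2 (w 1 0) p + mulL2 (w 1 1) r] : L2x2)) ∈ (matMulOp Ω).graph := by
  have key : ∀ j, (fun x => ∑ k, Ω x j k * (WithLp.toLp 2 ![p, r] : L2x2) k x) =ᵐ[volume]
      (mulL2 (w j 0) p + mulL2 (w j 1) r : L2) := by
    intro j
    filter_upwards [coeFn_mulL2 (w j 0) p, coeFn_mulL2 (w j 1) r,
      Lp.coeFn_add (mulL2 (w j 0) p) (mulL2 (w j 1) r)] with x h1 h2 h3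
    rw [h3, Pi.add_apply, h1, h2, Fin.sum_univ_two, hw, hw]
    rfl
  have hmem : ∀ j, MemLp (fun x => ∑ k, Ω x j k * (WithLp.toLp 2 ![p, r] : L2x2) k x) 2
      (volume : Measure Plane) := fun j => (Lp.memLp _).ae_eq (key j).symm
  refine (LinearPMap.mem_graph_iff _).2 ⟨⟨_, hmem⟩, rfl, ?_⟩
  ext1 j
  have hj : ∀ j, (hmem j).toLp _ = mulL2 (w j 0) p + mulL2 (w j 1) r := fun j =>
    Lp.ext ((MemLp.coeFn_toLp (hmem j)).trans (key j))
  fin_cases j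
  · exact hj 0
  · exact hj 1

/-- Only the inclusion of the formal adjoint `(P, R) ↦ a P + a* R` in `𝔸*` is needed, not a
description of the full domain of `𝔸*`. -/
theorem mem_graph_bigA_adjoint {P R y z : L2} (hP : Ann b P y) (hR : Cre b R z) :
    ((WithLp.toLp 2 ![P, R] : L2x2), y + z) ∈ (bigA b).adjoint.graph := by
  have key : ∀ x : (bigA b).domain, inner ℂ (y + z) (x : L2) =
      inner ℂ (WithLp.toLp 2 ![P, R] : L2x2) (bigA b x) := by
    intro x
    have hc : Cre b x (opAstar b ⟨x, x.2.1⟩) := (opAstar b).mem_graph ⟨x, x.2.1⟩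
    have ha : Ann b x (opA b ⟨x, x.2.2⟩) := (opA b).mem_graph ⟨x, x.2.2⟩
    rw [inner_add_left, hP.inner_eq hc, hR.inner_eq ha, PiLp.inner_apply, Fin.sum_univ_two]
    rfl
  have hmem : (WithLp.toLp 2 ![P, R] : L2x2) ∈ (bigA b).adjoint.domain :=
    LinearPMap.mem_adjoint_domain_of_exists _ ⟨_, key⟩
  exact (LinearPMap.mem_graph_iff _).2 ⟨⟨_, hmem⟩, rfl,
    LinearPMap.adjoint_apply_eq (dense_domain_bigA b) ⟨_, hmem⟩ key⟩

/-- The vectors `p₁, r₁, p₂, r₂` witness that `Ω 𝔸 u` lies in the domain of `𝔸*`, multiplication by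
the entries preserving the domains of `a` and `a*`. The value `y` is used only through the form `⟨𝔸
u', Ω 𝔸 u⟩`. -/
theorem exists_mem_graph_sandwich {Ω : Plane → Matrix (Fin 2) (Fin 2) ℂ}
    (w : Fin 2 → Fin 2 → cbFn) (hw : ∀ j k x, (w j k).1 x = Ω x j k) {u p r p₁ r₁ p₂ r₂ : L2}
    (hp : Cre b u p) (hr : Ann b u r) (hp₁ : Ann b p p₁) (hr₁ : Ann b r r₁) (hp₂ : Cre b p p₂)
    (hr₂ : Cre b r r₂) : ∃ y, (u, y) ∈ (sandwich b Ω).graph ∧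
      ∀ u' p' r', Cre b u' p' → Ann b u' r' → inner ℂ u' y =
        inner ℂ p' (mulL2 (w 0 0) p) + inner ℂ p' (mulL2 (w 0 1) r) +
        (inner ℂ r' (mulL2 (w 1 0) p) + inner ℂ r' (mulL2 (w 1 1) r)) := by
  have hP := (hp₁.mul (w 0 0)).add (hr₁.mul (w 0 1))
  have hR := (hp₂.mul (w 1 0)).add (hr₂.mul (w 1 1))
  refine ⟨_, mem_graph_pcomp (mem_graph_pcomp (mem_graph_bigA hp hr) (mem_graph_matMulOp w hw p r))
    (mem_graph_bigA_adjoint hP hR), fun u' p' r' hp' hr' => ?_⟩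
  rw [inner_add_right, ← hp'.inner_eq hP, ← hr'.inner_eq hR, inner_add_right, inner_add_right]

/-! ### The symbol -/

/-- Complex conjugation on `C_b^∞`. -/
def cbConj (w : cbFn) : cbFn := ⟨fun x => conj (w.1 x), w.2.conj⟩

/-- The symbol of a Hermitian matrix with entries `w j k`, as a `C_b^∞` function. -/
def cbSymbol (b : ℝ) (w : Fin 2 → Fin 2 → cbFn) : ℕ → cbFn
  | 0 => (2 * b : ℂ) • cbLaguerre b 1 0 (w 0 0)
  | q + 1 => (2 * b * (q + 2) : ℂ) • cbLaguerre b (q + 2) 0 (w 0 0)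
      + (2 * b * (q + 1) : ℂ) • cbLaguerre b q 0 (w 1 1)
      + (cbLaguerre b q 2 ((cbAnn ^ 2) (w 0 1)) + cbConj (cbLaguerre b q 2 ((cbAnn ^ 2) (w 0 1))))

/-- `∂/∂z̄` on `C_b^∞`. -/
def cbDzbar : Module.End ℂ cbFn := (1 / 2 : ℂ) • (cbPderiv 0 + Complex.I • cbPderiv 1)

theorem cbAnn_sq (w : cbFn) : (cbAnn ^ 2) w = (-4 : ℂ) • cbDzbar (cbDzbar w) := by
  have h : ∀ w, cbAnn w = (-2 * Complex.I) • cbDzbar w := fun w => by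
    rw [cbAnn, cbDzbar, LinearMap.smul_apply, LinearMap.smul_apply, smul_smul]
    congr 1
    ring
  rw [sq, Module.End.mul_apply, h, h, map_smul, smul_smul]
  congr 1
  linear_combination 4 * Complex.I_sq

theorem cbSymbol_coe {Ω : Plane → Matrix (Fin 2) (Fin 2) ℂ} {w : Fin 2 → Fin 2 → cbFn}
    (hw : ∀ j k, (w j k).1 = fun x => Ω x j k) (q : ℕ) : (cbSymbol b w q).1 = symbol b q Ω := by
  ext x
  rcases q with _ | q
  · change 2 * b * (cbLaguerre b 1 0 (w 0 0)).1 x = _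
    rw [cbLaguerre_coe, hw, symbol, if_pos rfl]
  · have h2 : (cbLaguerre b q 2 ((cbAnn ^ 2) (w 0 1))).1 x =
        -4 * polyLaplacian b (laguerre q 2) (dzbar (dzbar fun y => Ω y 0 1)) x := by
      rw [cbAnn_sq, map_smul]
      change -4 * (cbLaguerre b q 2 (cbDzbar (cbDzbar (w 0 1)))).1 x = _
      rw [cbLaguerre_coe, ← hw]
      rfl
    change 2 * b * (q + 2) * (cbLaguerre b (q + 2) 0 (w 0 0)).1 x
      + 2 * b * (q + 1) * (cbLaguerre b q 0 (w 1 1)).1 x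
      + ((cbLaguerre b q 2 ((cbAnn ^ 2) (w 0 1))).1 x
        + conj ((cbLaguerre b q 2 ((cbAnn ^ 2) (w 0 1))).1 x)) = _
    rw [h2, Complex.add_conj, cbLaguerre_coe, cbLaguerre_coe, hw, hw, symbol,
      if_neg (Nat.succ_ne_zero q), Nat.add_sub_cancel]
    have : (-4 * polyLaplacian b (laguerre q 2) (dzbar (dzbar fun y => Ω y 0 1)) x).re =
        -4 * (polyLaplacian b (laguerre q 2) (dzbar (dzbar fun y => Ω y 0 1)) x).re := by
      simp
    rw [this]
    push_cast
    ring

/-- The image under the annihilation operator of the `n`-th vector of a ladder. -/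
def lowered (b : ℝ) (F : ℕ → L2) : ℕ → L2
  | 0 => 0
  | n + 1 => (2 * b * (n + 1) : ℂ) • F n

/-- `F` is the sequence of the successive images of a vector of the lowest Landau level under the
creation operator. -/
structure IsLadder (b : ℝ) (F : ℕ → L2) : Prop where
  cre : ∀ n, Cre b (F n) (F (n + 1))
  ann : ∀ n, Ann b (F n) (lowered b F n)

theorem IsLadder.inner_mulL2 (hb : 0 < b) {F F' : ℕ → L2} (hF : IsLadder b F) (hF' : IsLadder b F')
    (s m : ℕ) (w : cbFn) :
    inner ℂ (F' (s + m)) (mulL2 w (F s)) = (2 * b) ^ s * s.factorial *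
      inner ℂ (F' 0) (mulL2 (cbLaguerre b s m ((cbAnn ^ m) w)) (F 0)) :=
  inner_ladder_mulL2 hb (hF.ann 0) (hF'.ann 0) hF.cre hF'.cre (fun n => hF.ann (n + 1)) s m w

theorem IsLadder.exists_ann_lowered {F : ℕ → L2} (hF : IsLadder b F) (n : ℕ) :
    ∃ v, Ann b (lowered b F n) v := by
  rcases n with _ | n
  · exact ⟨0, (opA b).graph.zero_mem⟩
  · exact ⟨_, (hF.ann n).smul _⟩

theorem IsLadder.exists_cre_lowered {F : ℕ → L2} (hF : IsLadder b F) (n : ℕ) :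
    ∃ v, Cre b (lowered b F n) v := by
  rcases n with _ | n
  · exact ⟨0, (opAstar b).graph.zero_mem⟩
  · exact ⟨_, (hF.cre n).smul _⟩

/-- The form of `𝔸* Ω 𝔸` on a Landau level, in terms of the symbol. -/
theorem IsLadder.form_eq (hb : 0 < b) {F F' : ℕ → L2} (hF : IsLadder b F) (hF' : IsLadder b F')
    {w : Fin 2 → Fin 2 → cbFn} (hw : ∀ x, (w 1 0).1 x = conj ((w 0 1).1 x)) (q : ℕ) :
    inner ℂ (F' (q + 1)) (mulL2 (w 0 0) (F (q + 1))) +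
        inner ℂ (F' (q + 1)) (mulL2 (w 0 1) (lowered b F q)) +
        (inner ℂ (lowered b F' q) (mulL2 (w 1 0) (F (q + 1))) +
          inner ℂ (lowered b F' q) (mulL2 (w 1 1) (lowered b F q))) =
      (2 * b) ^ q * q.factorial * inner ℂ (F' 0) (mulL2 (cbSymbol b w q) (F 0)) := by
  have h00 := hF.inner_mulL2 hb hF' (q + 1) 0 (w 0 0)
  rw [add_zero, pow_zero, Module.End.one_apply] at h00
  rw [h00]
  rcases q with _ | q
  · simp only [lowered, map_zero, inner_zero_left, inner_zero_right, add_zero, cbSymbol, mulL2_smul,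
      inner_smul_right]
    simp
  · have h11 := hF.inner_mulL2 hb hF' q 0 (w 1 1)
    rw [add_zero, pow_zero, Module.End.one_apply] at h11
    have h01 := hF.inner_mulL2 hb hF' q 2 (w 0 1)
    -- The entry `w 1 0` is the conjugate of `w 0 1`, so its matrix element is the conjugate of one
    -- with the two ladders exchanged. The two off-diagonal terms thus add up to the real part in
    -- the symbol.
    have h10 := hF'.inner_mulL2 hb hF q 2 (w 0 1)
    have hcj : conj (inner ℂ (F 0) (mulL2 (cbLaguerre b q 2 ((cbAnn ^ 2) (w 0 1))) (F' 0))) =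
        inner ℂ (F' 0) (mulL2 (cbConj (cbLaguerre b q 2 ((cbAnn ^ 2) (w 0 1)))) (F 0)) :=
      (inner_mulL2_conj (fun x => rfl) _ _).symm
    simp only [lowered, map_smul, inner_smul_left, inner_smul_right, inner_mulL2_conj hw, h01, h10,
      h11, cbSymbol, mulL2_add, mulL2_smul, inner_add_right, map_mul, map_pow, map_add, map_one,
      map_ofNat, Complex.conj_ofReal, map_natCast, hcj]
    -- At level `n = q + 1`, factoring out `(2b)^n n!` leaves `2b(n+1)` for `w 0 0`, `2bn` for `w 1
    -- 1` (two lowering factors `2bn`), and `1` for the off-diagonal entries (one such factor).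
    rw [Nat.factorial_succ (q + 1), Nat.factorial_succ q]
    push_cast
    ring

end Landau

end

/-! ### Transport of the compression to the lowest Landau level. -/

theorem proposition4p1 (b : ℝ) (hb : 0 < b)
    (Ω : Landau.Plane → Matrix (Fin 2) (Fin 2) ℂ)
    (hΩ : ∀ x, (Ω x).IsHermitian)
    (hsmooth : ∀ j k, Landau.IsCbInfty fun x => Ω x j k)
    (q : ℕ) :
    (Landau.compression b q (Landau.sandwich b Ω)).domain = ⊤ ∧
    (Landau.compression b 0 (Landau.mulOp (Landau.symbol b q Ω))).domain = ⊤ ∧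
    Landau.UnitarilyEquivalent
      (Landau.compression b q (Landau.sandwich b Ω))
      (Landau.compression b 0 (Landau.mulOp (Landau.symbol b q Ω))) := by
  obtain ⟨e, he0, hea, he⟩ := Landau.exists_level_equiv_pow hb
  have hlad : ∀ u, Landau.IsLadder b fun n => (Landau.ladderNorm b n : ℂ) • (e n u : Landau.L2) :=
    fun u => ⟨fun n => (he n u).1, fun n => by
      rcases n with _ | n
      · exact hea u
      · exact (he n u).2⟩
  let w : Fin 2 → Fin 2 → Landau.cbFn := fun j k => ⟨fun x => Ω x j k, hsmooth j k⟩
  have hw : ∀ x, (w 1 0).1 x = starRingEnd ℂ ((w 0 1).1 x) := fun x => ((hΩ x).apply 1 0).symm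
  have hsym : (Landau.cbSymbol b w q).1 = Landau.symbol b q Ω :=
    Landau.cbSymbol_coe (fun j k => rfl) q
  have hS : ∀ u : Landau.level b 0,
      (u, Landau.levelProj b 0 (Landau.mulL2 (Landau.cbSymbol b w q) u)) ∈
        (Landau.compression b 0 (Landau.mulOp (Landau.symbol b q Ω))).graph := fun u => by
    rw [← hsym]
    exact Landau.mem_graph_compression (Landau.mem_graph_mulOp _ _)
  have hNpos := Landau.ladderNorm_pos hb q
  have hN0 : (Landau.ladderNorm b q : ℂ) ≠ 0 := by exact_mod_cast hNpos.ne'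
  have hT : ∀ u : Landau.level b 0, ∃ y, (e q u, y) ∈
      (Landau.compression b q (Landau.sandwich b Ω)).graph ∧
      (e q).symm y = Landau.levelProj b 0 (Landau.mulL2 (Landau.cbSymbol b w q) u) := by
    intro u
    have hc := (hlad u).cre
    have ha := (hlad u).ann
    obtain ⟨r₁, hr₁⟩ := (hlad u).exists_ann_lowered q
    obtain ⟨r₂, hr₂⟩ := (hlad u).exists_cre_lowered q
    obtain ⟨y, hy, hform⟩ := Landau.exists_mem_graph_sandwich (Ω := Ω) w (fun _ _ _ => rfl)
      (hc q) (ha q) (ha (q + 1)) hr₁ (hc (q + 1)) hr₂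
    -- The ladder vector at height `q` is `ladderNorm b q • e q u`; dividing by the norm returns to
    -- the unitary `e q`.
    have hy' := (Landau.sandwich b Ω).graph.smul_mem ((Landau.ladderNorm b q : ℂ)⁻¹) hy
    rw [Prod.smul_mk, inv_smul_smul₀ hN0] at hy'
    -- Vectors of level `0` are identified by their inner products with every `v`. Both ladders
    -- contribute a factor `ladderNorm b q`, and the product cancels the `(2b)^q q!` of
    -- `IsLadder.form_eq`.
    refine ⟨_, Landau.mem_graph_compression hy', ext_inner_left ℂ fun v => ?_⟩
    have h := hform _ _ _ ((hlad v).cre q) ((hlad v).ann q)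
    rw [(hlad u).form_eq hb (hlad v) hw, ← Landau.ladderNorm_sq hb, inner_smul_left,
      Complex.conj_ofReal, he0, he0, mul_assoc] at h
    have h' := mul_left_cancel₀ hN0 h
    rw [Landau.inner_levelProj, ← (e q).inner_map_map, LinearIsometryEquiv.apply_symm_apply,
      Landau.inner_levelProj, inner_smul_right, h', inv_mul_cancel_left₀ hN0]
  refine ⟨Landau.domain_eq_top_of_forall fun x => ?_,
    Landau.domain_eq_top_of_forall fun u => ⟨_, hS u⟩,
    Landau.unitarilyEquivalent_of_forall (e q).symm fun x => ?_⟩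
  · obtain ⟨y, hy, -⟩ := hT ((e q).symm x)
    rw [LinearIsometryEquiv.apply_symm_apply] at hy
    exact ⟨y, hy⟩
  · obtain ⟨y, hy, hy'⟩ := hT ((e q).symm x)
    rw [LinearIsometryEquiv.apply_symm_apply] at hy
    refine ⟨y, hy, ?_⟩
    rw [hy']
    exact hS _
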